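/- All signatures are finite or countable, and formulas are first-order with equality. A constraint is a finite conjunction of literals, and $T\models\varphi$ means that $\varphi$ is true in all models of $T$ under all assignments to its free variables. Let $T$ be a universal theory (a set of sentences $\forall \underline{x}\,\varphi$ with $\varphi$ quantifier-free) in a signature that contains at least one individual constant. Recall the following definitions. * $T$ is *convex* if for every constraint $\delta$, every $n\ge 1$ and all variables $x_1,\dots,x_n,y_1,\dots,y_n$: if $T\models\delta\to\bigvee_{i=1}^n x_i=y_i$, then $T\models\delta\to x_i=y_i$ for some $i$. * $T$ is *stably infinite* if every constraint that is satisfiable in a model of $T$ is satisfiable in an infinite model of $T$. * $T$ *has a model completion* if there is a theory $T^*\supseteq T$ in the same signature such that every constraint satisfiable in a model of $T$ is satisfiable in a model of $T^*$, and for every formula $\varphi(\underline{x})$ there is a quantifier-free formula $\varphi'(\underline{x})$ with $T^*\models\varphi\leftrightarrow\varphi'$. * $T$ is *equality interpolating* if for all constraints $\delta_1(\underline{x},\underline{z}_1,y_1)$ and $\delta_2(\underline{x},\underline{z}_2,y_2)$ (where $\underline{x},\underline{z}_1,\underline{z}_2,y_1,y_2$ are pairwise disjoint, possibly empty tuples of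 distinct variables and single variables $y_1,y_2$) such that $T\models\delta_1\wedge\delta_2\to y_1=y_2$, there is a term $t(\underline{x})$ such that $T\models\delta_1\wedge\delta_2\to y_1=t(\underline{x})\wedge y_2=t(\underline{x})$. For a signature $\Sigma$, let $\mathcal{EUF}(\Sigma)$ be the pure theory of equality over $\Sigma$, that is, the theory in the signature $\Sigma$ without axioms. **Theorem.** Let $T$ be a convex, stably infinite, universal theory that has a model completion, in a signature that contains at least one individual constant, and let $\Sigma$ be a signature that is disjoint from the signature of $T$ and contains at least one unary predicate symbol. Then $T\cup\mathcal{EUF}(\Sigma)$, as a theory in the union of the two signatures, has a model completion if and only if $T$ is equality interpolating. -/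

import Mathlib

open FirstOrder

universe u v w

namespace FirstOrder.Language

variable {L : Language.{u, v}}

/-- A literal is an atomic formula or the negation of an atomic formula. -/
def Formula.IsLiteral {α : Type w} (φ : L.Formula α) : Prop :=
  BoundedFormula.IsAtomic φ ∨ ∃ ψ : L.Formula α, BoundedFormula.IsAtomic ψ ∧ φ = ∼ψ

/-- A constraint is a finite (possibly empty) conjunction of literals. -/
def Formula.IsConstraint {α : Type w} (φ : L.Formula α) : Prop :=
  ∃ l : List (L.Formula α), (∀ ψ ∈ l, ψ.IsLiteral) ∧ φ = l.foldr (· ⊓ ·) ⊤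

namespace Theory

/-- `T.SatisfiableFormula φ`: some model of `T` has an assignment of the free variables of `φ`
making `φ` true. As for Mathlib's `Theory.IsSatisfiable`, the models range over the universe of the
language, which by Löwenheim-Skolem is no restriction. -/
def SatisfiableFormula (T : L.Theory) {α : Type} (φ : L.Formula α) : Prop :=
  ∃ (M : ModelType.{u, v, max u v} T) (a : α → M), φ.Realize a

/-- Stably infinite: every `T`-satisfiable constraint is satisfiable in an infinite model of `T`. -/
def IsStablyInfinite (T : L.Theory) : Prop :=
  ∀ (n : ℕ) (φ : L.Formula (Fin n)), φ.IsConstraint → T.SatisfiableFormula φ →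
    ∃ (M : ModelType.{u, v, max u v} T) (a : Fin n → M), Infinite M ∧ φ.Realize a

/-- Convex: if a constraint `T`-entails a nonempty disjunction of equalities between variables,
then it `T`-entails one of them. -/
def IsConvex (T : L.Theory) : Prop :=
  ∀ (m : ℕ) (δ : L.Formula (Fin m)), δ.IsConstraint →
    ∀ (n : ℕ) (x y : Fin (n + 1) → Fin m),
      T ⊨ᵇ δ.imp (Formula.iSup fun i => Term.equal (Term.var (x i)) (Term.var (y i))) →
        ∃ i, T ⊨ᵇ δ.imp (Term.equal (Term.var (x i)) (Term.var (y i)))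

/-- Quantifier elimination: every formula is equivalent modulo `T` to a quantifier-free formula in
the same free variables. -/
def HasQuantifierElimination (T : L.Theory) : Prop :=
  ∀ (n : ℕ) (φ : L.Formula (Fin n)),
    ∃ ψ : L.Formula (Fin n), BoundedFormula.IsQF ψ ∧ T ⊨ᵇ φ.iff ψ

/-- `T` has a model completion: some `T' ⊇ T` in the same language eliminates quantifiers, and
every constraint satisfiable in a model of `T` is satisfiable in a model of `T'`. -/
def HasModelCompletion (T : L.Theory) : Prop :=
  ∃ T' : L.Theory, T ⊆ T' ∧
    (∀ (n : ℕ) (φ : L.Formula (Fin n)), φ.IsConstraint →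
      T.SatisfiableFormula φ → T'.SatisfiableFormula φ) ∧
    T'.HasQuantifierElimination

/-- Equality interpolating. The free variables of `δ₁(x, z₁, y₁)` are indexed by
`Fin p ⊕ (Fin q₁ ⊕ Unit)` (the tuple `x`, the tuple `z₁`, the variable `y₁`), likewise those of
`δ₂(x, z₂, y₂)`. In the conjunction of the two constraints the tuple `x` is shared, and
`z₁, y₁, z₂, y₂` are kept apart: the free variables are indexed by
`Fin p ⊕ ((Fin q₁ ⊕ Unit) ⊕ (Fin q₂ ⊕ Unit))`. -/
def IsEqualityInterpolating (T : L.Theory) : Prop :=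
  ∀ (p q₁ q₂ : ℕ) (δ₁ : L.Formula (Fin p ⊕ (Fin q₁ ⊕ Unit)))
    (δ₂ : L.Formula (Fin p ⊕ (Fin q₂ ⊕ Unit))), δ₁.IsConstraint → δ₂.IsConstraint →
    let δ : L.Formula (Fin p ⊕ ((Fin q₁ ⊕ Unit) ⊕ (Fin q₂ ⊕ Unit))) :=
      δ₁.relabel (Sum.map id Sum.inl) ⊓ δ₂.relabel (Sum.map id Sum.inr)
    let y₁ : L.Term (Fin p ⊕ ((Fin q₁ ⊕ Unit) ⊕ (Fin q₂ ⊕ Unit))) :=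
      Term.var (Sum.inr (Sum.inl (Sum.inr ())))
    let y₂ : L.Term (Fin p ⊕ ((Fin q₁ ⊕ Unit) ⊕ (Fin q₂ ⊕ Unit))) :=
      Term.var (Sum.inr (Sum.inr (Sum.inr ())))
    T ⊨ᵇ δ.imp (Term.equal y₁ y₂) →
      ∃ t : L.Term (Fin p),
        T ⊨ᵇ δ.imp (Term.equal y₁ (t.relabel Sum.inl) ⊓ Term.equal y₂ (t.relabel Sum.inl))

/-- `EUF(S)`: the pure theory of equality over the signature `S`; it has no axioms. -/
def euf (S : Language.{u, v}) : S.Theory := ∅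

/-- The union of theories in two disjoint signatures: the theory in the disjoint union of the
signatures whose axioms are those of both theories. -/
def disjointUnion {S : Language.{u, v}} (T : L.Theory) (T' : S.Theory) : (L.sum S).Theory :=
  (LHom.sumInl : L →ᴸ L.sum S).onTheory T ∪ (LHom.sumInr : S →ᴸ L.sum S).onTheory T'

end Theory

end FirstOrder.Language

/-! Having a model completion is replaced by a condition on single formulas, `HasCovers`. If `T*` is
a model completion, quantifier elimination for `∃ y, ε(x, y)` in `T*` yields a cover of `ε`.
Conversely, if models of the theory are closed under substructures, covers give enough existentially
closed models, and the theory of these models eliminates quantifiers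
(`HasModelCompletion.hasCovers`, `HasCovers.hasModelCompletion`).

Necessity (`isEqualityInterpolating_of_hasCovers`): let `δ₁ ∧ δ₂` entail `y₁ = y₂`, and let `ψ(x)`
be a cover of `δ₁(x, z₁, y₁) ∧ P(y₁)`. Suppose the common value `y` is none of the finitely many
term values to which `ψ` can apply a predicate of `S`. Then `ψ` cannot notice the removal of `y`
from `P`, so some extension still has a solution of `δ₁` in `P`. But `δ₂` persists there and forces
this solution to be `y`, a contradiction. So `y` is always one of finitely many terms in `x`, and
convexity selects a single one.

Sufficiency (`hasCovers_disjointUnion_euf`): by compactness it suffices to fix a solution `ε(a, b)`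
in a model `M` and to find a quantifier-free property of `a` that ensures solvability in extensions.
Only finitely many flat facts about `M` matter. The elements they mention split into those generated
by `a` and the rest, which become unknowns. By equality interpolation and covers for `T`, a
quantifier-free condition says that no unknown is determined (`exists_cover_ne`); by convexity, over
any model satisfying it the unknowns can then be realized by new elements
(`exists_solution_not_mem`). The symbols of `S` are unconstrained on tuples containing a new
element, so they can imitate `M` there. -/

namespace FirstOrder.Language

variable {L : Language.{u, v}}

/-! ### Literals, conjunctions and quantifier-free formulas -/

namespace Formula

/-- The conjunction of a list of formulas. -/
abbrev conj {α : Type*} (l : List (L.Formula α)) : L.Formula α := l.foldr (· ⊓ ·) ⊤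

theorem realize_conj {α : Type*} {M : Type*} [L.Structure M] (l : List (L.Formula α)) (x : α → M) :
    (conj l).Realize x ↔ ∀ φ ∈ l, φ.Realize x :=
  BoundedFormula.realize_foldr_inf l x default

theorem IsLiteral.isQF {α : Type*} {φ : L.Formula α} (h : φ.IsLiteral) :
    BoundedFormula.IsQF φ := by
  rcases h with h | ⟨ψ, h, rfl⟩
  · exact h.isQF
  · exact h.isQF.not

theorem IsLiteral.relabel {α β : Type*} {φ : L.Formula α} (h : φ.IsLiteral) (f : α → β) :
    (φ.relabel f).IsLiteral := by
  rcases h with h | ⟨ψ, h, rfl⟩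
  · exact Or.inl (BoundedFormula.IsAtomic.relabel h _)
  · exact Or.inr ⟨ψ.relabel f, BoundedFormula.IsAtomic.relabel h _, rfl⟩

theorem isQF_relabel {α β : Type*} {φ : L.Formula α} (h : BoundedFormula.IsQF φ) (f : α → β) :
    BoundedFormula.IsQF (φ.relabel f) :=
  BoundedFormula.IsQF.relabel h _

theorem isQF_conj {α : Type*} {l : List (L.Formula α)}
    (h : ∀ φ ∈ l, BoundedFormula.IsQF φ) : BoundedFormula.IsQF (conj l) := by
  induction l with
  | nil => exact BoundedFormula.IsQF.top
  | cons a l ih =>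
    exact (h a (by simp)).inf (ih fun φ hφ => h φ (by simp [hφ]))

theorem isLiteral_equal {α : Type*} (s t : L.Term α) : (s.equal t).IsLiteral :=
  Or.inl (BoundedFormula.IsAtomic.equal _ _)

theorem isLiteral_not_equal {α : Type*} (s t : L.Term α) : (Formula.not (s.equal t)).IsLiteral :=
  Or.inr ⟨s.equal t, BoundedFormula.IsAtomic.equal _ _, rfl⟩

theorem isLiteral_rel {α : Type*} {n : ℕ} (R : L.Relations n) (ts : Fin n → L.Term α) :
    (R.formula ts).IsLiteral :=
  Or.inl (BoundedFormula.IsAtomic.rel _ _)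

theorem isLiteral_not_rel {α : Type*} {n : ℕ} (R : L.Relations n) (ts : Fin n → L.Term α) :
    (Formula.not (R.formula ts)).IsLiteral :=
  Or.inr ⟨R.formula ts, BoundedFormula.IsAtomic.rel _ _, rfl⟩

theorem isConstraint_conj {α : Type*} {l : List (L.Formula α)} (h : ∀ φ ∈ l, φ.IsLiteral) :
    (conj l).IsConstraint :=
  ⟨l, h, rfl⟩

theorem realize_of_isQF {α : Type*} {M N : Type*} [L.Structure M] [L.Structure N]
    {φ : L.Formula α} (h : BoundedFormula.IsQF φ) (f : M ↪[L] N) (x : α → M) :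
    φ.Realize (f ∘ x) ↔ φ.Realize x := by
  rw [Formula.Realize, Formula.Realize, ← h.realize_embedding f]
  exact iff_of_eq (congrArg _ (Subsingleton.elim _ _))

/-- Truth of a formula depends only on the values of its free variables. -/
theorem realize_congr {α : Type*} [DecidableEq α] {M : Type*} [L.Structure M] (φ : L.Formula α)
    {x y : α → M} (h : ∀ a ∈ φ.freeVarFinset, x a = y a) : φ.Realize x ↔ φ.Realize y := by
  rw [Formula.Realize, Formula.Realize,
    ← BoundedFormula.realize_restrictFreeVar (φ := φ) (f := id) (v := fun a => x a) (v' := x)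
      (fun _ => rfl),
    ← BoundedFormula.realize_restrictFreeVar (φ := φ) (f := id) (v := fun a => x a) (v' := y)
      (fun a => h a a.2)]

/-- The complete description of the truth value of a quantifier-free formula at a point: there is a
constraint true at the point that decides the formula. -/
theorem exists_literals_decide {α : Type*} {M : Type*} [L.Structure M] {φ : L.Formula α}
    (h : BoundedFormula.IsQF φ) (x : α → M) :
    ∃ l : List (L.Formula α), (∀ ψ ∈ l, ψ.IsLiteral) ∧ (conj l).Realize x ∧
      ∀ (N : Type w) [L.Structure N] (y : α → N), (conj l).Realize y →
        (φ.Realize y ↔ φ.Realize x) := by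
  induction h with
  | falsum => exact ⟨[], by simp, by simp, fun _ _ _ _ => Iff.rfl⟩
  | @of_isAtomic φ h =>
    by_cases hx : Formula.Realize φ x
    · exact ⟨[φ], fun ψ hψ => List.mem_singleton.1 hψ ▸ Or.inl h, by simpa using hx,
        fun N _ y hy => iff_of_true (by simpa [realize_conj] using hy) hx⟩
    · exact ⟨[∼φ], fun ψ hψ => List.mem_singleton.1 hψ ▸ Or.inr ⟨φ, h, rfl⟩,
        by simpa [realize_conj] using hx,
        fun N _ y hy => iff_of_false (by simpa [realize_conj] using hy) hx⟩
  | @imp φ₁ φ₂ _ _ ih₁ ih₂ =>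
    obtain ⟨l₁, h₁, hx₁, hd₁⟩ := ih₁
    obtain ⟨l₂, h₂, hx₂, hd₂⟩ := ih₂
    rw [realize_conj] at hx₁ hx₂
    refine ⟨l₁ ++ l₂, ?_, ?_, fun N _ y hy => ?_⟩
    · intro ψ hψ
      rcases List.mem_append.1 hψ with h | h
      exacts [h₁ ψ h, h₂ ψ h]
    · rw [realize_conj]
      intro ψ hψ
      rcases List.mem_append.1 hψ with h | h
      exacts [hx₁ ψ h, hx₂ ψ h]
    · rw [realize_conj] at hy
      exact imp_congr (hd₁ N y ((realize_conj _ _).2 fun ψ hψ => hy ψ (by simp [hψ])))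
        (hd₂ N y ((realize_conj _ _).2 fun ψ hψ => hy ψ (by simp [hψ])))

end Formula

/-- A finite set of variables is contained in the range of an injection from some `Fin n` that has
a left inverse on this set. -/
theorem exists_fin_retraction {α : Type*} (s : Finset α) :
    ∃ (n : ℕ) (g : Fin n → α) (r : α → Fin n), (∀ i, r (g i) = i) ∧ ∀ a ∈ s, g (r a) = a := by
  classical
  rcases isEmpty_or_nonempty α with hα | ⟨⟨a₀⟩⟩
  · exact ⟨0, Fin.elim0, isEmptyElim, fun i => i.elim0, fun a => isEmptyElim a⟩
  · let e := (insert a₀ s).equivFin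
    refine ⟨_, fun i => e.symm i, fun a => if h : a ∈ insert a₀ s then e ⟨a, h⟩ else
      e ⟨a₀, Finset.mem_insert_self _ _⟩, fun i => ?_, fun a ha => ?_⟩
    · simp only [(e.symm i).2, dif_pos, Subtype.coe_eta, _root_.Equiv.apply_symm_apply]
    · simp only [Finset.mem_insert_of_mem ha, dif_pos, _root_.Equiv.symm_apply_apply]

/-! ### Compactness for sets of formulas and diagrams -/

namespace Theory

variable {T : L.Theory}

/-- Compactness for sets of formulas with free variables. -/
theorem exists_realize_of_finite (T : L.Theory) {α : Type w} (Γ : Set (L.Formula α))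
    (h : ∀ s : Finset (L.Formula α), (s : Set (L.Formula α)) ⊆ Γ →
      ∃ (N : ModelType.{u, v, max u v w} T) (x : α → N), ∀ φ ∈ s, φ.Realize x) :
    ∃ (N : ModelType.{u, v, max u v w} T) (x : α → N), ∀ φ ∈ Γ, φ.Realize x := by
  classical
  let T' : L[[α]].Theory := (L.lhomWithConstants α).onTheory T ∪ Formula.equivSentence '' Γ
  have hsat : T'.IsSatisfiable := by
    rw [isSatisfiable_iff_isFinitelySatisfiable]
    intro T0 hT0
    let s : Finset (L.Formula α) := (T0.image Formula.equivSentence.symm).filter (· ∈ Γ)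
    obtain ⟨N, x, hx⟩ := h s (fun φ hφ => (Finset.mem_filter.1 hφ).2)
    let : (constantsOn α).Structure N := constantsOn.structure x
    have : N ⊨ (T0 : L[[α]].Theory) := by
      refine ⟨fun φ hφ => ?_⟩
      rcases hT0 hφ with h1 | ⟨ψ, hψ, rfl⟩
      · have : N ⊨ (L.lhomWithConstants α).onTheory T := (LHom.onTheory_model _ _).2 inferInstance
        exact this.realize_of_mem _ h1
      · rw [Formula.realize_equivSentence]
        exact hx ψ (Finset.mem_filter.2 ⟨Finset.mem_image.2 ⟨_, hφ, by simp⟩, hψ⟩)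
    exact Model.isSatisfiable N
  obtain ⟨N⟩ := hsat
  let : L.Structure N := (L.lhomWithConstants α).reduct N
  have hN : N ⊨ T' := N.is_model
  have hT : N ⊨ T := (LHom.onTheory_model (L.lhomWithConstants α) T).1
    (hN.mono Set.subset_union_left)
  refine ⟨ModelType.of T N, fun a => (L.con a : N), fun φ hφ => ?_⟩
  have := hN.realize_of_mem (Formula.equivSentence φ) (Or.inr ⟨φ, hφ, rfl⟩)
  rwa [Formula.realize_equivSentence] at this

/-- Compactness for extensions of a structure: a set of formulas with parameters in `M` is
realized in a model of `T` extending `M` as soon as each finite part of it is consistent with `T`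
and each finite part of the diagram of `M`. -/
theorem exists_embedding_of_finite (T : L.Theory) (M : Type max u v) [L.Structure M] {β : Type}
    (Γ : Set (L.Formula (M ⊕ β)))
    (h : ∀ l : List (L.Formula M), (∀ φ ∈ l, φ.IsLiteral ∧ φ.Realize (id : M → M)) →
      ∀ s : Finset (L.Formula (M ⊕ β)), (s : Set (L.Formula (M ⊕ β))) ⊆ Γ →
        ∃ (N : ModelType.{u, v, max u v} T) (x : M ⊕ β → N),
          (∀ φ ∈ l, φ.Realize (x ∘ Sum.inl)) ∧ ∀ φ ∈ s, φ.Realize x) :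
    ∃ (N : ModelType.{u, v, max u v} T) (f : M ↪[L] N) (b : β → N),
      ∀ φ ∈ Γ, φ.Realize (Sum.elim f b) := by
  classical
  let D : Set (L.Formula M) := {φ | φ.IsLiteral ∧ φ.Realize (id : M → M)}
  obtain ⟨N, x, hx⟩ := exists_realize_of_finite T (α := M ⊕ β)
    (Γ ∪ (fun φ : L.Formula M => φ.relabel Sum.inl) '' D) (by
      intro s hs
      obtain ⟨s₁, s₂, hs₁, hs₂, hs'⟩ : ∃ (s₁ : Finset (L.Formula (M ⊕ β)))
          (s₂ : Finset (L.Formula M)), (s₁ : Set (L.Formula (M ⊕ β))) ⊆ Γ ∧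
          (s₂ : Set (L.Formula M)) ⊆ D ∧
          ∀ φ ∈ s, φ ∈ s₁ ∨ ∃ ψ ∈ s₂, ψ.relabel Sum.inl = φ := by
        induction s using Finset.induction_on with
        | empty => exact ⟨∅, ∅, by simp, by simp, by simp⟩
        | insert a s _ ih =>
          obtain ⟨s₁, s₂, hs₁, hs₂, hs'⟩ := ih (fun φ hφ => hs (Finset.mem_insert_of_mem hφ))
          rcases hs (Finset.mem_insert_self a s) with ha | ⟨ψ, hψ, rfl⟩
          · refine ⟨insert a s₁, s₂, ?_, hs₂, ?_⟩
            · simpa [Set.insert_subset_iff] using ⟨ha, hs₁⟩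
            · intro φ hφ
              rcases Finset.mem_insert.1 hφ with rfl | hφ
              · simp
              · rcases hs' φ hφ with h | h
                · simp [h]
                · exact Or.inr h
          · refine ⟨s₁, insert ψ s₂, hs₁, ?_, ?_⟩
            · simpa [Set.insert_subset_iff] using ⟨hψ, hs₂⟩
            · intro φ hφ
              rcases Finset.mem_insert.1 hφ with rfl | hφ
              · exact Or.inr ⟨ψ, by simp, rfl⟩
              · rcases hs' φ hφ with h | ⟨χ, hχ, h⟩
                · exact Or.inl h
                · exact Or.inr ⟨χ, by simp [hχ], h⟩
      obtain ⟨N, x, hx₁, hx₂⟩ := h s₂.toList (fun φ hφ => hs₂ (by simpa using hφ)) s₁ hs₁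
      refine ⟨N, x, fun φ hφ => ?_⟩
      rcases hs' φ hφ with h | ⟨ψ, hψ, rfl⟩
      · exact hx₂ φ h
      · rw [Formula.realize_relabel]
        exact hx₁ ψ (by simpa using hψ))
  have hD : ∀ φ ∈ D, φ.Realize (x ∘ Sum.inl) := fun φ hφ => by
    have := hx _ (Or.inr ⟨φ, hφ, rfl⟩)
    rwa [Formula.realize_relabel] at this
  refine ⟨N, ⟨⟨x ∘ Sum.inl, fun a b hab => ?_⟩, fun {n} f ys => ?_, fun {n} R ys => ?_⟩,
    x ∘ Sum.inr, fun φ hφ => ?_⟩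
  · by_contra hne
    have := hD (∼((Term.var a).equal (Term.var b)))
      ⟨Formula.isLiteral_not_equal _ _, by simpa using hne⟩
    exact (by simpa using this : ¬ _) hab
  · have := hD ((Term.func f fun i => Term.var (ys i)).equal (Term.var (Structure.funMap f ys)))
      ⟨Formula.isLiteral_equal _ _, by simp⟩
    simpa [Function.comp_def] using this.symm
  · constructor
    · intro hR
      by_contra hne
      have := hD (∼(R.formula fun i => Term.var (ys i)))
        ⟨Formula.isLiteral_not_rel _ _, by simpa using hne⟩
      exact (by simpa using this : ¬ Structure.RelMap R fun i => x (Sum.inl (ys i))) hR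
    · intro hR
      have := hD (R.formula fun i => Term.var (ys i))
        ⟨Formula.isLiteral_rel _ _, by simpa using hR⟩
      simpa [Function.comp_def] using this
  · have := hx φ (Or.inl hφ)
    convert this using 1
    ext a
    rcases a with a | a <;> rfl

end Theory
end FirstOrder.Language

/-! ### Covers, and how a model completion provides them -/

namespace FirstOrder.Language

variable {L : Language.{u, v}}
namespace Theory

variable {T : L.Theory}

/-- `T` has covers: for every quantifier-free `ε(x, y)` there is a quantifier-free `ψ(x)` that
defines, in all models of `T`, the tuples `x` for which `ε(x, y)` is solvable in some extension
that is a model of `T`. -/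
def HasCovers (T : L.Theory) : Prop :=
  ∀ (n : ℕ) (β : Type) [Finite β] (ε : L.Formula (Fin n ⊕ β)), BoundedFormula.IsQF ε →
    ∃ ψ : L.Formula (Fin n), BoundedFormula.IsQF ψ ∧
      (∀ (M : ModelType.{u, v, max u v} T) (a : Fin n → M) (b : β → M),
        ε.Realize (Sum.elim a b) → ψ.Realize a) ∧
      ∀ (M : ModelType.{u, v, max u v} T) (a : Fin n → M), ψ.Realize a →
        ∃ (N : ModelType.{u, v, max u v} T) (f : M ↪[L] N) (b : β → N),
          ε.Realize (Sum.elim (f ∘ a) b)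

/-- If the constraints satisfiable in `T` are satisfiable in `T'`, so are the quantifier-free
formulas. -/
theorem exists_realize_of_isQF {T T' : L.Theory}
    (h : ∀ (n : ℕ) (φ : L.Formula (Fin n)), φ.IsConstraint →
      T.SatisfiableFormula φ → T'.SatisfiableFormula φ)
    {α : Type*} {φ : L.Formula α} (hφ : BoundedFormula.IsQF φ)
    (M : ModelType.{u, v, max u v} T) (x : α → M) (hx : φ.Realize x) :
    ∃ (N : ModelType.{u, v, max u v} T') (y : α → N), φ.Realize y := by
  classical
  obtain ⟨l, hl, hlx, hd⟩ := Formula.exists_literals_decide hφ x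
  -- Satisfiability transfer is given only for constraints in variables from some `Fin n`, so the
  -- finitely many variables that occur are renamed along `r`.
  obtain ⟨n, g, r, -, hr⟩ := exists_fin_retraction
    (l.toFinset.biUnion fun ψ => ψ.freeVarFinset)
  obtain ⟨N, y, hy⟩ := h n (Formula.conj (l.map (Formula.relabel r)))
    (Formula.isConstraint_conj (by
      simp only [List.mem_map]
      rintro _ ⟨ψ, hψ, rfl⟩
      exact (hl ψ hψ).relabel r))
    ⟨M, x ∘ g, by
      rw [Formula.realize_conj] at hlx ⊢
      simp only [List.mem_map]
      rintro _ ⟨ψ, hψ, rfl⟩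
      rw [Formula.realize_relabel, Formula.realize_congr (y := x)]
      · exact hlx ψ hψ
      · intro a ha
        simp only [Function.comp_apply]
        rw [hr a (Finset.mem_biUnion.2 ⟨ψ, by simpa using hψ, ha⟩)]⟩
  refine ⟨N, y ∘ r, (hd N (y ∘ r) ?_).2 hx⟩
  rw [Formula.realize_conj] at hy ⊢
  intro ψ hψ
  rw [← Formula.realize_relabel]
  exact hy _ (List.mem_map.2 ⟨ψ, hψ, rfl⟩)

/-- The cover is the quantifier-free equivalent of `∃ y, ε(x, y)` modulo `T'`. A model of `T` itself
need not extend to a model of `T'`: each finite part of its diagram together with `ψ` is satisfiable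
in `T'`, where `ψ` provides a solution, and compactness assembles the extension, which only has to
be a model of `T`. -/
theorem HasModelCompletion.hasCovers (h : T.HasModelCompletion) : T.HasCovers := by
  obtain ⟨T', hsub, hsat, hqe⟩ := h
  intro n β _ ε hε
  obtain ⟨ψ, hψ, hiff⟩ := hqe n (ε.iExs β)
  rw [models_formula_iff] at hiff
  have hiff' : ∀ (N : ModelType.{u, v, max u v} T') (a : Fin n → N),
      (∃ b : β → N, ε.Realize (Sum.elim a b)) ↔ ψ.Realize a := fun N a => by
    rw [← Formula.realize_iExs, ← Formula.realize_iff]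
    exact hiff N a
  refine ⟨ψ, hψ, fun M a b hab => ?_, fun M a ha => ?_⟩
  · by_contra hna
    obtain ⟨N, y, hy⟩ := exists_realize_of_isQF hsat (φ := ε ⊓ Formula.not (ψ.relabel Sum.inl))
      (hε.inf (Formula.isQF_relabel hψ Sum.inl).not) M (Sum.elim a b)
      (Formula.realize_inf.2 ⟨hab, by simpa using hna⟩)
    rw [Formula.realize_inf, Formula.realize_not, Formula.realize_relabel] at hy
    exact hy.2 ((hiff' N _).1 ⟨y ∘ Sum.inr, by simpa using hy.1⟩)
  · obtain ⟨N, f, b, hb⟩ := exists_embedding_of_finite T M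
      {ε.relabel (Sum.map a (id : β → β))} (by
        intro l hl s hs
        obtain ⟨N, y, hy⟩ := exists_realize_of_isQF hsat (φ := Formula.conj l ⊓ ψ.relabel a)
          ((Formula.isQF_conj fun φ hφ => (hl φ hφ).1.isQF).inf (Formula.isQF_relabel hψ a)) M id
          (by
            rw [Formula.realize_inf, Formula.realize_conj]
            exact ⟨fun φ hφ => (hl φ hφ).2, by simpa using ha⟩)
        rw [Formula.realize_inf, Formula.realize_conj, Formula.realize_relabel] at hy
        obtain ⟨b, hb⟩ := (hiff' N _).2 hy.2
        have : N ⊨ T := N.is_model.mono hsub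
        refine ⟨ModelType.of T N, Sum.elim y b, hy.1, fun φ hφ => ?_⟩
        rw [Set.mem_singleton_iff.1 (hs hφ), Formula.realize_relabel]
        exact Sum.elim_comp_map (f₁ := a) (g₁ := (id : β → β)) (f₂ := y) (g₂ := b) ▸ hb)
    refine ⟨N, f, b, ?_⟩
    have := hb _ rfl
    rwa [Formula.realize_relabel, Sum.elim_comp_map] at this

end Theory
end FirstOrder.Language

/-! ### Existentially closed models, and model completions from covers -/

namespace FirstOrder.Language

variable {L : Language.{u, v}}

/-- Variables for the construction of existentially closed models: variables `base i`, and a witness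
`wit n ε t` for each formula `ε(x, y)` and each tuple `t` of variables. -/
inductive WitnessVar (L : Language.{u, v}) : Type max u v
  | base : ℕ → WitnessVar L
  | wit : (n : ℕ) → L.Formula (Fin n ⊕ Unit) → (Fin n → WitnessVar L) → WitnessVar L

namespace WitnessVar

/-- The nesting depth of a witness variable. -/
def depth : WitnessVar L → ℕ
  | base _ => 0
  | wit _ _ t => (Finset.univ.sup fun i => (t i).depth) + 1

theorem depth_lt {n : ℕ} (ε : L.Formula (Fin n ⊕ Unit)) (t : Fin n → WitnessVar L) (i : Fin n) :
    (t i).depth < (wit n ε t).depth :=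
  Nat.lt_succ_of_le (Finset.le_sup (f := fun i => (t i).depth) (Finset.mem_univ i))

end WitnessVar

namespace Theory

variable {T : L.Theory}

/-- A structure is existentially closed for `T` if it contains a solution of each quantifier-free
formula `ε(a, y)`, `y` a single variable, that has a solution in an extension modelling `T`. -/
def IsExistentiallyClosed (T : L.Theory) (M : Type max u v) [L.Structure M] : Prop :=
  ∀ (n : ℕ) (ε : L.Formula (Fin n ⊕ Unit)), BoundedFormula.IsQF ε → ∀ a : Fin n → M,
    (∃ (N : ModelType.{u, v, max u v} T) (f : M ↪[L] N) (b : Unit → N),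
      ε.Realize (Sum.elim (f ∘ a) b)) → ∃ b : Unit → M, ε.Realize (Sum.elim a b)

open WitnessVar in
/-- A theory with covers whose models are closed under substructures has enough existentially
closed models. -/
theorem HasCovers.exists_isExistentiallyClosed (hT : T.HasCovers)
    (hsub : ∀ (N : ModelType.{u, v, max u v} T) (A : Type max u v) [L.Structure A],
      (A ↪[L] N) → A ⊨ T)
    {n : ℕ} {φ : L.Formula (Fin n)} (hφ : BoundedFormula.IsQF φ) (h : T.SatisfiableFormula φ) :
    ∃ (M : ModelType.{u, v, max u v} T) (a : Fin n → M),
      T.IsExistentiallyClosed M ∧ φ.Realize a := by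
  classical
  obtain ⟨M₀, a₀, ha₀⟩ := h
  choose ψ hψ hψ₁ hψ₂ using fun (n : ℕ) => hT n Unit
  let ι := Σ n : ℕ, { ε : L.Formula (Fin n ⊕ Unit) // BoundedFormula.IsQF ε } ×
    (Fin n → WitnessVar L)
  let wv : ι → WitnessVar L := fun i => wit i.1 i.2.1.1 i.2.2
  have wv_inj : Function.Injective wv := by
    rintro ⟨n, ⟨ε, hε⟩, t⟩ ⟨n', ⟨ε', hε'⟩, t'⟩ h
    simp only [wv, wit.injEq] at h
    obtain ⟨rfl, h, h'⟩ := h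
    obtain rfl := eq_of_heq h
    obtain rfl := eq_of_heq h'
    rfl
  -- A Henkin condition: if the cover promises a solution, the named witness is one. Meeting all of
  -- these at once by compactness avoids iterated unions of chains.
  let Sol : ∀ (N : ModelType.{u, v, max u v} T) (x : WitnessVar L → N), ι → Prop := fun N x i =>
    (ψ i.1 i.2.1.1 i.2.1.2).Realize (x ∘ i.2.2) →
      i.2.1.1.Realize (Sum.elim (x ∘ i.2.2) fun _ => x (wv i))
  have hfin : ∀ s : Finset ι, ∃ (N : ModelType.{u, v, max u v} T) (x : WitnessVar L → N),
      φ.Realize (fun i : Fin n => x (base i)) ∧ ∀ i ∈ s, Sol N x i := by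
    intro s
    -- Witnesses are treated in order of nesting depth. The new one has maximal depth, so it is not
    -- an argument of any condition in play, and reassigning it keeps the conditions already met.
    induction s using Finset.induction_on_max_value (fun i => (wv i).depth) with
    | empty =>
      obtain ⟨m⟩ := M₀.nonempty'
      refine ⟨M₀, fun x => match x with
        | base k => if h : k < n then a₀ ⟨k, h⟩ else m
        | wit _ _ _ => m, ?_, by simp⟩
      simpa using ha₀
    | insert i s his hmax ih =>
      obtain ⟨N, x, hx, hs⟩ := ih
      by_cases hi : (ψ i.1 i.2.1.1 i.2.1.2).Realize (x ∘ i.2.2)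
      · obtain ⟨N', f, b, hb⟩ := hψ₂ _ _ _ N _ hi
        let x' : WitnessVar L → N' := Function.update (f ∘ x) (wv i) (b ())
        have hargs : ∀ j : ι, (wv j).depth ≤ (wv i).depth → x' ∘ j.2.2 = f ∘ x ∘ j.2.2 := by
          intro j hj
          funext k
          refine Function.update_of_ne (a := j.2.2 k) (a' := wv i) (fun hk => ?_) _ _
          have := depth_lt j.2.1.1 j.2.2 k
          rw [hk] at this
          exact absurd this (not_lt.2 hj)
        refine ⟨N', x', ?_, fun j hj => ?_⟩
        · have : (fun k : Fin n => x' (base k)) = f ∘ fun k : Fin n => x (base k) := by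
            funext k
            exact Function.update_of_ne (a := base k) (a' := wv i) (fun hk => by cases hk) _ _
          rw [this, Formula.realize_of_isQF hφ]
          exact hx
        · rcases Finset.mem_insert.1 hj with rfl | hj
          · intro _
            rw [hargs j le_rfl]
            convert hb using 2
            funext k
            exact Function.update_self _ _ _
          · have hne : wv j ≠ wv i := fun h => his (wv_inj h ▸ hj)
            have hw : (fun _ : Unit => x' (wv j)) = f ∘ fun _ => x (wv j) := by
              funext _
              exact Function.update_of_ne hne _ _
            intro h
            rw [hargs j (hmax j hj), Formula.realize_of_isQF (hψ _ _ _)] at h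
            rw [hargs j (hmax j hj), hw, ← Sum.comp_elim, Formula.realize_of_isQF j.2.1.2]
            exact hs j hj h
      · refine ⟨N, x, hx, fun j hj => ?_⟩
        rcases Finset.mem_insert.1 hj with rfl | hj
        · exact fun h => absurd h hi
        · exact hs j hj
  let γ : Option ι → L.Formula (WitnessVar L) := fun o => o.elim
    (φ.relabel fun i : Fin n => base i)
    fun i => ((ψ i.1 i.2.1.1 i.2.1.2).relabel i.2.2).imp
      (i.2.1.1.relabel (Sum.elim i.2.2 fun _ => wv i))
  have hγ : ∀ (N : ModelType.{u, v, max u v} T) (x : WitnessVar L → N) (i : ι),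
      (γ (some i)).Realize x ↔ Sol N x i := fun N x i => by
    simp only [γ, Sol, Option.elim, Formula.realize_imp, Formula.realize_relabel, Sum.comp_elim]
    rfl
  obtain ⟨N, x, hx⟩ := exists_realize_of_finite T (Set.range γ) (by
    intro s hs
    obtain ⟨s', -, rfl⟩ := Finset.subset_set_image_iff.1 (Set.image_univ ▸ hs)
    obtain ⟨N, x, hx, hs'⟩ := hfin (s'.eraseNone)
    refine ⟨N, x, fun χ hχ => ?_⟩
    obtain ⟨o, ho, rfl⟩ := Finset.mem_image.1 hχ
    cases o with
    | none => simpa [γ, Function.comp_def] using hx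
    | some i => exact (hγ N x i).2 (hs' i (Finset.mem_eraseNone.2 ho)))
  have hsol : ∀ i, Sol N x i := fun i => (hγ N x i).1 (hx _ ⟨some i, rfl⟩)
  have hwit : ∀ (k : ℕ) (ε : L.Formula (Fin k ⊕ Unit)) (hε : BoundedFormula.IsQF ε)
      (t : Fin k → WitnessVar L), (ψ k ε hε).Realize (x ∘ t) →
        ε.Realize (Sum.elim (x ∘ t) fun _ => x (wit k ε t)) :=
    fun k ε hε t => hsol ⟨k, ⟨ε, hε⟩, t⟩
  -- The values of the variables are closed under functions, because `f(t) = y` is itself one of the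
  -- formulas with a witness. The variables `base i` keep this set nonempty even without constants.
  let A : L.Substructure N := ⟨Set.range x, by
    intro k f ys hys
    choose t ht using hys
    obtain rfl : x ∘ t = ys := funext ht
    have := hwit k ((Term.func f fun i => Term.var (Sum.inl i)).equal (Term.var (Sum.inr ())))
      (Formula.isLiteral_equal _ _).isQF t
      (hψ₁ _ _ _ N (x ∘ t) (fun _ => Structure.funMap f (x ∘ t)) (by simp [Function.comp_def]))
    rw [Formula.realize_equal] at this
    exact ⟨_, this.symm⟩⟩
  have hA : A ⊨ T := hsub N A A.subtype
  have : Nonempty A := ⟨⟨x (base 0), base 0, rfl⟩⟩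
  let a : Fin n → A := fun i => ⟨x (base i), base i, rfl⟩
  refine ⟨ModelType.of T A, a, ?_, ?_⟩
  · rintro k ε hε c ⟨N', f, b, hb⟩
    -- Being quantifier-free, the cover passes from the extension `N'` down to `A` and up to `N`,
    -- where the Henkin condition applies.
    have h1 : (ψ k ε hε).Realize c := (Formula.realize_of_isQF (hψ _ _ _) f c).1 (hψ₁ _ _ _ N' _ b hb)
    choose t ht using fun i => (c i).2
    have hc : A.subtype ∘ c = x ∘ t := funext fun i => (ht i).symm
    have h2 := hwit k ε hε t (by rw [← hc]; exact (Formula.realize_of_isQF (hψ _ _ _) A.subtype c).2 h1)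
    refine ⟨fun _ => ⟨x (wit k ε t), _, rfl⟩, ?_⟩
    refine (Formula.realize_of_isQF hε A.subtype _).1 ?_
    convert h2 using 1
    funext j
    rcases j with j | j
    · exact (ht j).symm
    · rfl
  · refine (Formula.realize_of_isQF hφ A.subtype _).1 ?_
    have := hx _ ⟨none, rfl⟩
    exact (Formula.realize_relabel (g := fun i : Fin n => base i)).1 this

theorem isQF_toFormula {α : Type*} {k : ℕ} {φ : L.BoundedFormula α k} (h : φ.IsQF) :
    BoundedFormula.IsQF φ.toFormula := by
  induction h with
  | falsum => exact .falsum
  | of_isAtomic h =>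
    cases h with
    | equal t₁ t₂ => exact (Formula.isLiteral_equal t₁ t₂).isQF
    | rel R ts => exact (Formula.isLiteral_rel R ts).isQF
  | imp _ _ ih₁ ih₂ => exact ih₁.imp ih₂

/-- In existentially closed models of a theory with covers, every formula is equivalent to a
quantifier-free one. -/
theorem HasCovers.exists_isQF_iff (hT : T.HasCovers) {n k : ℕ} (φ : L.BoundedFormula (Fin n) k) :
    ∃ ψ : L.BoundedFormula (Fin n) k, ψ.IsQF ∧
      ∀ M : ModelType.{u, v, max u v} T, T.IsExistentiallyClosed M →
        ∀ (a : Fin n → M) (xs : Fin k → M), φ.Realize a xs ↔ ψ.Realize a xs := by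
  refine BoundedFormula.induction_on_exists_not (P := fun {k} (φ : L.BoundedFormula (Fin n) k) =>
    ∃ ψ : L.BoundedFormula (Fin n) k, ψ.IsQF ∧
      ∀ M : ModelType.{u, v, max u v} T, T.IsExistentiallyClosed M →
        ∀ (a : Fin n → M) (xs : Fin k → M), φ.Realize a xs ↔ ψ.Realize a xs) φ ?_ ?_ ?_ ?_
  · exact fun {_ ψ} hψ => ⟨ψ, hψ, fun _ _ _ _ => Iff.rfl⟩
  · rintro k φ ⟨ψ, hψ, h⟩
    exact ⟨ψ.not, hψ.not, fun M hM a xs => not_congr (h M hM a xs)⟩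
  · rintro k φ ⟨ψ, hψ, h⟩
    -- The quantified variable, which is the last one, becomes the unknown; all others become
    -- parameters.
    let e : Fin n ⊕ Fin (k + 1) → Fin (n + k) ⊕ Unit := Sum.elim
      (fun i => Sum.inl (Fin.castAdd k i))
      (Fin.snoc (fun i => Sum.inl (Fin.natAdd n i)) (Sum.inr ()))
    let ε : L.Formula (Fin (n + k) ⊕ Unit) := ψ.toFormula.relabel e
    have hε : BoundedFormula.IsQF ε := Formula.isQF_relabel (isQF_toFormula hψ) e
    obtain ⟨χ, hχ, hχ₁, hχ₂⟩ := hT (n + k) Unit ε hε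
    refine ⟨BoundedFormula.relabel (n := k) (k := 0) finSumFinEquiv.symm χ, hχ.relabel _, fun M hM a xs => ?_⟩
    have key : ∀ b : Unit → M, ε.Realize (Sum.elim (Sum.elim a xs ∘ finSumFinEquiv.symm) b) ↔
        ψ.Realize a (Fin.snoc xs (b ())) := by
      intro b
      simp only [ε, Formula.realize_relabel, BoundedFormula.realize_toFormula]
      refine iff_of_eq (congrArg₂ _ ?_ ?_)
      · funext i
        simp [e]
      · funext i
        refine Fin.lastCases ?_ (fun i => ?_) i <;> simp [e]
    have hχ' : BoundedFormula.Realize (BoundedFormula.relabel (n := k) (k := 0)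
        finSumFinEquiv.symm χ) a xs ↔ χ.Realize (Sum.elim a xs ∘ finSumFinEquiv.symm) := by
      rw [BoundedFormula.realize_relabel, Formula.Realize]
      exact iff_of_eq (congrArg₂ _ rfl (Subsingleton.elim _ _))
    rw [hχ', BoundedFormula.realize_ex]
    constructor
    · rintro ⟨m, hm⟩
      exact hχ₁ M _ (fun _ => m) ((key _).2 ((h M hM _ _).1 hm))
    · intro hm
      obtain ⟨b, hb⟩ := hM _ ε hε _ (hχ₂ M _ hm)
      exact ⟨b (), (h M hM _ _).2 ((key b).1 hb)⟩
  · intro k φ₁ φ₂ h12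
    refine exists_congr fun ψ => and_congr_right fun _ => forall_congr' fun M =>
      forall_congr' fun _ => forall_congr' fun a => forall_congr' fun xs => ?_
    rw [h12.realize_bd_iff]

theorem HasCovers.hasModelCompletion (hT : T.HasCovers)
    (hsub : ∀ (N : ModelType.{u, v, max u v} T) (A : Type max u v) [L.Structure A],
      (A ↪[L] N) → A ⊨ T) : T.HasModelCompletion := by
  let T' : L.Theory := {σ | ∀ M : ModelType.{u, v, max u v} T, T.IsExistentiallyClosed M → M ⊨ σ}
  refine ⟨T', fun σ hσ M _ => M.is_model.realize_of_mem σ hσ, fun n φ hφ hsat => ?_,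
    fun n φ => ?_⟩
  · obtain ⟨l, hl, rfl⟩ := hφ
    obtain ⟨M, a, hM, ha⟩ := hT.exists_isExistentiallyClosed hsub
      (Formula.isQF_conj fun ψ hψ => (hl ψ hψ).isQF) hsat
    have : M ⊨ T' := ⟨fun σ hσ => hσ M hM⟩
    exact ⟨ModelType.of T' M, a, ha⟩
  · obtain ⟨ψ, hψ, h⟩ := hT.exists_isQF_iff φ
    refine ⟨ψ, hψ, models_formula_iff.2 fun M a => ?_⟩
    -- A model of `T'` need not be existentially closed; the equivalence reaches it as a sentence,
    -- the universal closure, which belongs to `T'`.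
    have : M ⊨ Formula.iAlls (Fin n) (Formula.relabel (Sum.inr : Fin n → Empty ⊕ Fin n)
        (Formula.iff φ ψ)) := by
      refine M.is_model.realize_of_mem _ fun N hN => ?_
      rw [Sentence.Realize, Formula.realize_iAlls]
      intro b
      rw [Formula.realize_relabel, Formula.realize_iff]
      exact h N hN b default
    rw [Sentence.Realize, Formula.realize_iAlls] at this
    have := this a
    rwa [Formula.realize_relabel] at this

end Theory
end FirstOrder.Language

/-! ### Convexity, and necessity of equality interpolation -/

namespace FirstOrder.Language

variable {L : Language.{u, v}}
namespace Theory

variable {T : L.Theory}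

/-- Convexity for constraints over any set of variables. -/
theorem IsConvex.exists_var_eq (hT : T.IsConvex) {α ι : Type*} [Finite ι] [Nonempty ι]
    {l : List (L.Formula α)} (hl : ∀ φ ∈ l, φ.IsLiteral) (s t : ι → α)
    (h : ∀ (N : ModelType.{u, v, max u v} T) (x : α → N), (∀ φ ∈ l, φ.Realize x) →
      ∃ i, x (s i) = x (t i)) :
    ∃ i, ∀ (N : ModelType.{u, v, max u v} T) (x : α → N), (∀ φ ∈ l, φ.Realize x) →
      x (s i) = x (t i) := by
  classical
  have := Fintype.ofFinite ι
  obtain ⟨m, g, r, -, hr⟩ := exists_fin_retraction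
    ((l.toFinset.biUnion fun ψ => ψ.freeVarFinset) ∪ Finset.univ.image s ∪ Finset.univ.image t)
  obtain ⟨n, ⟨e⟩⟩ : ∃ n, Nonempty (Fin (n + 1) ≃ ι) := by
    obtain ⟨n, hn⟩ := Nat.exists_eq_succ_of_ne_zero (Fintype.card_ne_zero (α := ι))
    exact ⟨n, ⟨(Fintype.equivFinOfCardEq hn).symm⟩⟩
  obtain ⟨i, hi⟩ := hT m (Formula.conj (l.map (Formula.relabel r)))
    (Formula.isConstraint_conj (by
      simp only [List.mem_map]
      rintro _ ⟨ψ, hψ, rfl⟩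
      exact (hl ψ hψ).relabel r)) n (r ∘ s ∘ e) (r ∘ t ∘ e) (models_formula_iff.2 fun N x => by
        rw [Formula.realize_imp, Formula.realize_iSup, Formula.realize_conj]
        intro hx
        obtain ⟨i, hi⟩ := h N (x ∘ r) fun φ hφ =>
          Formula.realize_relabel.1 (hx _ (List.mem_map.2 ⟨φ, hφ, rfl⟩))
        exact ⟨e.symm i, by simpa using hi⟩)
  refine ⟨e i, fun N x hx => ?_⟩
  have := models_formula_iff.1 hi N (x ∘ g)
  rw [Formula.realize_imp, Formula.realize_conj] at this
  have := this (by
    simp only [List.mem_map]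
    rintro _ ⟨ψ, hψ, rfl⟩
    rw [Formula.realize_relabel, Formula.realize_congr (y := x)]
    · exact hx ψ hψ
    · intro a ha
      simp only [Function.comp_apply]
      rw [hr a (Finset.mem_union_left _ (Finset.mem_union_left _
        (Finset.mem_biUnion.2 ⟨ψ, by simpa using hψ, ha⟩)))])
  have hs : g (r (s (e i))) = s (e i) := hr _ (by simp)
  have ht : g (r (t (e i))) = t (e i) := hr _ (by simp)
  simpa [hs, ht] using this

/-- Convexity for equalities between terms. -/
theorem IsConvex.exists_term_eq (hT : T.IsConvex) {α ι : Type*} [Finite ι] [Nonempty ι]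
    {l : List (L.Formula α)} (hl : ∀ φ ∈ l, φ.IsLiteral) (s t : ι → L.Term α)
    (h : ∀ (N : ModelType.{u, v, max u v} T) (x : α → N), (∀ φ ∈ l, φ.Realize x) →
      ∃ i, (s i).realize x = (t i).realize x) :
    ∃ i, ∀ (N : ModelType.{u, v, max u v} T) (x : α → N), (∀ φ ∈ l, φ.Realize x) →
      (s i).realize x = (t i).realize x := by
  classical
  have := Fintype.ofFinite ι
  -- Each term gets a fresh variable with its defining equation as an additional literal, which
  -- reduces the claim to equalities of variables.
  let var' : ι ⊕ ι → L.Term (α ⊕ (ι ⊕ ι)) := fun i => Term.var (Sum.inr i)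
  let def' : ι ⊕ ι → L.Formula (α ⊕ (ι ⊕ ι)) := fun i =>
    (var' i).equal ((Sum.elim s t i).relabel Sum.inl)
  let l' := l.map (Formula.relabel Sum.inl) ++ (Finset.univ.toList.map def')
  have hl' : ∀ (N : ModelType.{u, v, max u v} T) (x : α ⊕ (ι ⊕ ι) → N),
      (∀ φ ∈ l', φ.Realize x) ↔ (∀ φ ∈ l, φ.Realize (x ∘ Sum.inl)) ∧
        ∀ i, x (Sum.inr i) = (Sum.elim s t i).realize (x ∘ Sum.inl) := fun N x => by
    simp only [l', def', var', List.forall_mem_append, List.forall_mem_map, Formula.realize_relabel,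
      Formula.realize_equal, Term.realize_relabel, Term.realize_var, Finset.mem_toList,
      Finset.mem_univ, true_implies]
  obtain ⟨i, hi⟩ := hT.exists_var_eq (l := l') (by
      simp only [l', List.forall_mem_append, List.forall_mem_map]
      exact ⟨fun φ hφ => (hl φ hφ).relabel _, fun i _ => Formula.isLiteral_equal _ _⟩)
    (fun i : ι => Sum.inr (Sum.inl i)) (fun i => Sum.inr (Sum.inr i)) (fun N x hx => by
      rw [hl'] at hx
      obtain ⟨i, hi⟩ := h N (x ∘ Sum.inl) hx.1
      exact ⟨i, by rw [hx.2, hx.2]; exact hi⟩)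
  refine ⟨i, fun N x hx => ?_⟩
  exact hi N (Sum.elim x fun i => (Sum.elim s t i).realize x) ((hl' _ _).2 ⟨by simpa using hx,
    by simp⟩)

end Theory

theorem LHom.isQF_onFormula {L' : Language} (g : L →ᴸ L') {α : Type*} {φ : L.Formula α}
    (h : BoundedFormula.IsQF φ) : BoundedFormula.IsQF (g.onFormula φ) := by
  induction h with
  | falsum => exact .falsum
  | of_isAtomic h =>
    cases h with
    | equal t₁ t₂ => exact .of_isAtomic (.equal _ _)
    | rel R ts => exact .of_isAtomic (.rel _ _)
  | imp _ _ ih₁ ih₂ => exact ih₁.imp ih₂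

namespace Theory

variable {S : Language.{u, v}}

theorem models_disjointUnion_euf_iff (T : L.Theory) (M : Type*) [L.Structure M]
    [(L.sum S).Structure M] [(LHom.sumInl : L →ᴸ L.sum S).IsExpansionOn M] :
    M ⊨ T.disjointUnion (euf S) ↔ M ⊨ T := by
  rw [disjointUnion, euf, model_union_iff, LHom.onTheory_model]
  refine and_iff_left ⟨fun φ hφ => ?_⟩
  simp [LHom.onTheory] at hφ

variable {T : L.Theory}

/-- The expansion of a model of `T` that interprets all function symbols of `S` by a constant
and all relation symbols of `S` by the powers of a set `X`. -/
def predModel (S : Language.{u, v}) (c : L.Constants) (M : ModelType.{u, v, max u v} T)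
    (X : Set M) : ModelType.{u, v, max u v} (T.disjointUnion (euf S)) :=
  letI : S.Structure M := ⟨fun _ _ => (c : M), fun _ xs => ∀ i, xs i ∈ X⟩
  haveI : M ⊨ T.disjointUnion (euf S) := (models_disjointUnion_euf_iff T M).2 inferInstance
  ModelType.of _ M

/-- Replaces each subterm that starts with a function symbol of `S` by a constant. -/
def collapseTerm {α : Type*} (c : L.Constants) : (L.sum S).Term α → L.Term α
  | .var a => .var a
  | .func (Sum.inl f) ts => .func f fun i => collapseTerm c (ts i)
  | .func (Sum.inr _) _ => c.term

theorem realize_collapseTerm {α : Type*} (c : L.Constants) (M : ModelType.{u, v, max u v} T)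
    (X : Set M) (x : α → M) (t : (L.sum S).Term α) :
    Term.realize (M := predModel S c M X) x t = (collapseTerm c t).realize x := by
  induction t with
  | var a => rfl
  | func f ts ih =>
    rcases f with f | f
    · simp only [collapseTerm, Term.realize_func]
      exact congrArg _ (funext ih)
    · exact Term.realize_constants.symm

theorem realize_onFormula_predModel {α : Type*} (c : L.Constants) (M : ModelType.{u, v, max u v} T)
    (X : Set M) (x : α → M) (φ : L.Formula α) :
    Formula.Realize (M := predModel S c M X) ((LHom.sumInl : L →ᴸ L.sum S).onFormula φ) x ↔
      φ.Realize x :=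
  let _ : S.Structure M := ⟨fun _ _ => (c : M), fun _ xs => ∀ i, xs i ∈ X⟩
  LHom.realize_onFormula (L' := L.sum S) (M := M) LHom.sumInl φ

/-- Removing an element `y` from the predicates changes the truth value of a quantifier-free formula
only if `y` is the value of one of finitely many terms. -/
theorem exists_terms_predModel {α : Type*} (c : L.Constants) {ψ : (L.sum S).Formula α}
    (hψ : BoundedFormula.IsQF ψ) :
    ∃ s : List (L.Term α), ∀ (M : ModelType.{u, v, max u v} T) (x : α → M) (y : M),
      (∀ t ∈ s, y ≠ t.realize x) →
        (Formula.Realize (M := predModel S c M Set.univ) ψ x ↔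
          Formula.Realize (M := predModel S c M {y}ᶜ) ψ x) := by
  induction hψ with
  | falsum => exact ⟨[], fun _ _ _ _ => Iff.rfl⟩
  | of_isAtomic h =>
    cases h with
    | equal t₁ t₂ =>
      refine ⟨[], fun M x y _ => ?_⟩
      have h : ∀ X : Set M, ∀ t : (L.sum S).Term (α ⊕ Fin 0),
        Term.realize (M := predModel S c M X) (Sum.elim x default) t =
          (collapseTerm c t).realize (Sum.elim x default) :=
        fun X t => realize_collapseTerm c M X _ t
      exact iff_of_eq (congrArg₂ (fun a b : M => a = b) ((h _ t₁).trans (h _ t₁).symm)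
        ((h _ t₂).trans (h _ t₂).symm))
    | @rel k R ts =>
      refine ⟨List.ofFn fun i => (collapseTerm c (ts i)).relabel (Sum.elim id Fin.elim0),
        fun M x y hy => ?_⟩
      have h : ∀ X : Set M, ∀ t : (L.sum S).Term (α ⊕ Fin 0),
        Term.realize (M := predModel S c M X) (Sum.elim x default) t =
          (collapseTerm c t).realize (Sum.elim x default) :=
        fun X t => realize_collapseTerm c M X _ t
      have h' : ∀ X : Set M, (fun i => Term.realize (M := predModel S c M X) (Sum.elim x default)
          (ts i)) = fun i => (collapseTerm c (ts i)).realize (Sum.elim x default) :=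
        fun X => funext fun i => h X (ts i)
      have h'' : ∀ X : Set M, Formula.Realize (M := predModel S c M X) (R.boundedFormula ts) x ↔
          Structure.RelMap (M := predModel S c M X) R
            fun i => (collapseTerm c (ts i)).realize (Sum.elim x default) :=
        fun X => iff_of_eq (congrArg (Structure.RelMap (M := predModel S c M X) R) (h' X))
      rw [h'', h'']
      rcases R with R | R
      · exact Iff.rfl
      · refine iff_of_true (fun _ => trivial) fun i => ?_
        have := hy _ (List.mem_ofFn.2 ⟨i, rfl⟩)
        rw [Term.realize_relabel] at this
        refine fun h => this (h.symm.trans ?_)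
        refine congrArg (fun z => Term.realize z (collapseTerm c (ts i))) (funext fun j => ?_)
        rcases j with j | j
        · rfl
        · exact j.elim0
  | imp _ _ ih₁ ih₂ =>
    obtain ⟨s₁, h₁⟩ := ih₁
    obtain ⟨s₂, h₂⟩ := ih₂
    exact ⟨s₁ ++ s₂, fun M x y h => imp_congr
      (h₁ M x y fun t ht => h t (by simp [ht])) (h₂ M x y fun t ht => h t (by simp [ht]))⟩

/-- The models `predModel` make every `S`-function constant, so each term inside the cover reduces
to an `L`-term in the shared variables. Only finitely many values can then be told apart from the
rest by predicates. -/
theorem isEqualityInterpolating_of_hasCovers (hconst : Nonempty L.Constants)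
    (hpred : Nonempty (S.Relations 1)) (hconv : T.IsConvex)
    (h : (T.disjointUnion (euf S)).HasCovers) : T.IsEqualityInterpolating := by
  classical
  obtain ⟨c⟩ := hconst
  obtain ⟨P⟩ := hpred
  rintro p q₁ q₂ _ _ ⟨l₁, hl₁, rfl⟩ ⟨l₂, hl₂, rfl⟩ δ y₁ y₂ hδ
  rw [models_formula_iff] at hδ
  have hδ' : ∀ (M : ModelType.{u, v, max u v} T) (x : Fin p → M) (z₁ : Fin q₁ ⊕ Unit → M)
      (z₂ : Fin q₂ ⊕ Unit → M), (Formula.conj l₁).Realize (Sum.elim x z₁) →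
      (Formula.conj l₂).Realize (Sum.elim x z₂) → z₁ (Sum.inr ()) = z₂ (Sum.inr ()) := by
    intro M x z₁ z₂ h₁ h₂
    have := hδ M (Sum.elim x (Sum.elim z₁ z₂))
    simp only [δ, y₁, y₂, Formula.realize_imp, Formula.realize_inf, Formula.realize_relabel,
      Formula.realize_equal, Sum.elim_comp_map, Sum.elim_comp_inl, Sum.elim_comp_inr,
      Function.comp_id, Term.realize_var, Sum.elim_inr, Sum.elim_inl] at this
    exact this ⟨h₁, h₂⟩
  obtain ⟨ψ, hψ, hψ₁, hψ₂⟩ := h p (Fin q₁ ⊕ Unit)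
    ((LHom.sumInl : L →ᴸ L.sum S).onFormula (Formula.conj l₁) ⊓
      Relations.formula (L := L.sum S) (Sum.inr P : (L.sum S).Relations 1)
        fun _ => Term.var (Sum.inr (Sum.inr ())))
    ((LHom.isQF_onFormula _ (Formula.isQF_conj fun φ hφ => (hl₁ φ hφ).isQF)).inf
      (Formula.isLiteral_rel _ _).isQF)
  obtain ⟨s, hs⟩ := exists_terms_predModel (T := T) c hψ
  -- The constant keeps the list nonempty, as convexity requires.
  let t : Fin (c.term :: s).length → L.Term (Fin p) := (c.term :: s).get
  have key : ∀ (M : ModelType.{u, v, max u v} T) (x : Fin p → M) (z₁ : Fin q₁ ⊕ Unit → M)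
      (z₂ : Fin q₂ ⊕ Unit → M), (Formula.conj l₁).Realize (Sum.elim x z₁) →
      (Formula.conj l₂).Realize (Sum.elim x z₂) →
      ∃ i, z₁ (Sum.inr ()) = (t i).realize x := by
    intro M x z₁ z₂ h₁ h₂
    by_contra hne
    push Not at hne
    have hM₁ := hψ₁ (predModel S c M Set.univ) x z₁ (by
      rw [Formula.realize_inf]
      exact ⟨(realize_onFormula_predModel c M _ _ _).2 h₁,
        (Formula.realize_rel (L := L.sum S) (R := Sum.inr P)).2 fun _ => trivial⟩)
    have hM₂ := (hs M x (z₁ (Sum.inr ())) fun t' ht' => by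
      obtain ⟨i, rfl⟩ := List.mem_iff_get.1 (List.mem_cons_of_mem c.term ht')
      exact hne i).1 hM₁
    -- The cover still holds after `y₁` has left the predicates, so an extension has a solution `b`
    -- of `δ₁` with its last entry in `P`. There `δ₂` identifies this entry with the image of `y₁`,
    -- which is not in `P`.
    obtain ⟨N, f, b, hb⟩ := hψ₂ (predModel S c M {z₁ (Sum.inr ())}ᶜ) x hM₂
    let _ : L.Structure N := (LHom.sumInl : L →ᴸ L.sum S).reduct N
    have hN : N ⊨ T := (models_disjointUnion_euf_iff (S := S) T N).1 N.is_model
    rw [Formula.realize_inf, LHom.realize_onFormula] at hb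
    have h₂' := (Formula.realize_of_isQF (LHom.isQF_onFormula (LHom.sumInl : L →ᴸ L.sum S)
      (Formula.isQF_conj fun φ hφ => (hl₂ φ hφ).isQF)) f (Sum.elim x z₂)).2
      ((realize_onFormula_predModel c M _ _ _).2 h₂)
    rw [LHom.realize_onFormula] at h₂'
    have heq : b (Sum.inr ()) = f (z₂ (Sum.inr ())) :=
      hδ' (ModelType.of T N) (f ∘ x) b (f ∘ z₂) hb.1 (Sum.comp_elim f x z₂ ▸ h₂')
    rw [← hδ' M x z₁ z₂ h₁ h₂] at heq
    have hP := (Formula.realize_rel (L := L.sum S) (R := Sum.inr P)).1 hb.2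
    simp only [Term.realize_var, Sum.elim_inr, heq] at hP
    exact (f.map_rel (Sum.inr P : (L.sum S).Relations 1) fun _ => z₁ (Sum.inr ())).1 hP 0 rfl
  obtain ⟨i, hi⟩ := hconv.exists_term_eq
    (l := l₁.map (Formula.relabel (Sum.map id Sum.inl)) ++
      l₂.map (Formula.relabel (Sum.map id Sum.inr))) (by
      simp only [List.forall_mem_append, List.forall_mem_map]
      exact ⟨fun φ hφ => (hl₁ φ hφ).relabel _, fun φ hφ => (hl₂ φ hφ).relabel _⟩)
    (fun _ => y₁) (fun i => (t i).relabel Sum.inl) (fun N x hx => by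
      simp only [List.forall_mem_append, List.forall_mem_map, Formula.realize_relabel] at hx
      obtain ⟨i, hi⟩ := key N (x ∘ Sum.inl) (x ∘ Sum.inr ∘ Sum.inl) (x ∘ Sum.inr ∘ Sum.inr)
        ((Formula.realize_conj _ _).2 fun φ hφ => by
          convert hx.1 φ hφ using 1
          funext a; rcases a with a | a <;> rfl)
        ((Formula.realize_conj _ _).2 fun φ hφ => by
          convert hx.2 φ hφ using 1
          funext a; rcases a with a | a <;> rfl)
      exact ⟨i, by rw [Term.realize_relabel]; exact hi⟩)
  refine ⟨t i, models_formula_iff.2 fun N x => ?_⟩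
  have hδx := hδ N x
  rw [Formula.realize_imp] at hδx ⊢
  intro hx
  have h12 := hδx hx
  simp only [δ, Formula.realize_inf, Formula.realize_relabel] at hx
  have h1 := hi N x (by
    simp only [List.forall_mem_append, List.forall_mem_map, Formula.realize_relabel]
    exact ⟨(Formula.realize_conj _ _).1 hx.1, (Formula.realize_conj _ _).1 hx.2⟩)
  rw [Formula.realize_equal] at h12
  rw [Formula.realize_inf, Formula.realize_equal, Formula.realize_equal]
  exact ⟨h1, h12.symm.trans h1⟩

end Theory
end FirstOrder.Language

/-! ### Undetermined unknowns, and a local criterion for covers -/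

namespace FirstOrder.Language

variable {L : Language.{u, v}}

theorem Formula.isQF_subst {α β : Type*} {φ : L.Formula α} (h : BoundedFormula.IsQF φ)
    (σ : α → L.Term β) : BoundedFormula.IsQF (BoundedFormula.subst φ σ) := by
  induction h with
  | falsum => exact .falsum
  | of_isAtomic h =>
    cases h with
    | equal t₁ t₂ => exact .of_isAtomic (.equal _ _)
    | rel R ts => exact .of_isAtomic (.rel _ _)
  | imp _ _ ih₁ ih₂ => exact ih₁.imp ih₂

namespace Theory

variable {T : L.Theory}

/-- If a constraint over a model `M` of a convex theory is solvable in an extension and determines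
none of its unknowns, then it has a solution all of whose entries lie outside of `M`. -/
theorem IsConvex.exists_solution_not_mem (hT : T.IsConvex) (M : ModelType.{u, v, max u v} T)
    {α : Type*} {β : Type} {l : List (L.Formula (α ⊕ β))} (hl : ∀ φ ∈ l, φ.IsLiteral) (c : α → M)
    (h₀ : ∃ (N : ModelType.{u, v, max u v} T) (f : M ↪[L] N) (b : β → N),
      ∀ φ ∈ l, φ.Realize (Sum.elim (f ∘ c) b))
    (h : ∀ w, ∃ (N : ModelType.{u, v, max u v} T) (f : M ↪[L] N) (b b' : β → N),
      (∀ φ ∈ l, φ.Realize (Sum.elim (f ∘ c) b)) ∧ (∀ φ ∈ l, φ.Realize (Sum.elim (f ∘ c) b')) ∧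
        b w ≠ b' w) :
    ∃ (N : ModelType.{u, v, max u v} T) (f : M ↪[L] N) (b : β → N),
      (∀ φ ∈ l, φ.Realize (Sum.elim (f ∘ c) b)) ∧ ∀ w m, b w ≠ f m := by
  classical
  let ρ : α ⊕ β → M ⊕ β := Sum.map c id
  have hρ : ∀ (N : Type max u v) (f : M → N) (b : β → N), Sum.elim f b ∘ ρ = Sum.elim (f ∘ c) b :=
    fun N f b => Sum.elim_comp_map
  let ne : β × M → L.Formula (M ⊕ β) := fun i =>
    Formula.not ((Term.var (Sum.inr i.1)).equal (Term.var (Sum.inl i.2)))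
  obtain ⟨N, f, b, hb⟩ := exists_embedding_of_finite T M
    ((Formula.relabel ρ '' {φ | φ ∈ l}) ∪ ne '' Set.univ) (by
      intro l₀ hl₀ s hs
      by_contra hcon
      push Not at hcon
      obtain ⟨s', -, hs'⟩ := Finset.subset_set_image_iff.1
        (show ((s.filter (· ∈ ne '' Set.univ) : Finset _) : Set _) ⊆ ne '' Set.univ from
          fun φ hφ => (Finset.mem_filter.1 hφ).2)
      -- If the required inequalities were finitely inconsistent, the constraint and part of the
      -- diagram would entail a disjunction of equalities between unknowns and elements of `M`.
      have key : ∀ (N : ModelType.{u, v, max u v} T) (x : M ⊕ β → N),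
          (∀ φ ∈ l₀.map (Formula.relabel Sum.inl) ++ l.map (Formula.relabel ρ), φ.Realize x) →
          ∃ i : s', x (Sum.inr i.1.1) = x (Sum.inl i.1.2) := by
        intro N x hx
        simp only [List.forall_mem_append, List.forall_mem_map] at hx
        obtain ⟨φ, hφs, hφ⟩ := hcon N x fun φ hφ => Formula.realize_relabel.1 (hx.1 φ hφ)
        rcases hs hφs with ⟨ψ, hψ, rfl⟩ | hne
        · exact absurd (hx.2 ψ hψ) hφ
        · have : φ ∈ s'.image ne := hs' ▸ Finset.mem_filter.2 ⟨hφs, hne⟩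
          obtain ⟨i, hi, rfl⟩ := Finset.mem_image.1 this
          refine ⟨⟨i, hi⟩, ?_⟩
          simpa [ne] using hφ
      have sat : ∀ (N : ModelType.{u, v, max u v} T) (f : M ↪[L] N) (b : β → N),
          (∀ φ ∈ l, φ.Realize (Sum.elim (f ∘ c) b)) →
          ∀ φ ∈ l₀.map (Formula.relabel Sum.inl) ++ l.map (Formula.relabel ρ),
            φ.Realize (Sum.elim f b) := by
        intro N f b hb
        simp only [List.forall_mem_append, List.forall_mem_map, Formula.realize_relabel, hρ,
          Sum.elim_comp_inl]
        exact ⟨fun φ hφ => (Formula.realize_of_isQF (hl₀ φ hφ).1.isQF f id).2 (hl₀ φ hφ).2, hb⟩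
      rcases isEmpty_or_nonempty s' with hemp | hne
      · obtain ⟨N, f, b, hb⟩ := h₀
        exact hemp.elim (key N _ (sat N f b hb)).choose
      · obtain ⟨⟨⟨w, m⟩, _⟩, hi⟩ := hT.exists_var_eq (by
          simp only [List.forall_mem_append, List.forall_mem_map]
          exact ⟨fun φ hφ => (hl₀ φ hφ).1.relabel _, fun φ hφ => (hl φ hφ).relabel _⟩) _ _ key
        -- Convexity has fixed one equality `w = m`; both solutions live over the same embedding, so
        -- both would take the value `f m` at `w`.
        obtain ⟨N, f, b, b', hb, hb', hne⟩ := h w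
        exact hne ((hi N _ (sat N f b hb)).trans (hi N _ (sat N f b' hb')).symm))
  refine ⟨N, f, b, fun φ hφ => ?_, fun w m hwm => ?_⟩
  · have := hb _ (Or.inl ⟨φ, hφ, rfl⟩)
    rwa [Formula.realize_relabel, hρ] at this
  · have := hb _ (Or.inr ⟨(w, m), trivial, rfl⟩)
    rw [Formula.realize_not, Formula.realize_equal] at this
    exact this hwm

/-- In an equality interpolating theory with covers, it is a quantifier-free condition on the
parameters of a constraint that it does not determine its unknown `w`, and this condition holds
whenever `w` is not the value of a term in the parameters. -/
theorem IsEqualityInterpolating.exists_cover_ne (hT : T.IsEqualityInterpolating)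
    (hcov : T.HasCovers) {p q : ℕ} {l : List (L.Formula (Fin p ⊕ Fin q))}
    (hl : ∀ φ ∈ l, φ.IsLiteral) (w : Fin q) :
    ∃ ψ : L.Formula (Fin p), BoundedFormula.IsQF ψ ∧
      (∀ (M : ModelType.{u, v, max u v} T) (c : Fin p → M) (b : Fin q → M),
        (∀ φ ∈ l, φ.Realize (Sum.elim c b)) → (∀ t : L.Term (Fin p), b w ≠ t.realize c) →
          ψ.Realize c) ∧
      ∀ (M : ModelType.{u, v, max u v} T) (c : Fin p → M), ψ.Realize c →
        ∃ (N : ModelType.{u, v, max u v} T) (f : M ↪[L] N) (b b' : Fin q → N),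
          (∀ φ ∈ l, φ.Realize (Sum.elim (f ∘ c) b)) ∧
          (∀ φ ∈ l, φ.Realize (Sum.elim (f ∘ c) b')) ∧ b w ≠ b' w := by
  classical
  let ε : L.Formula (Fin p ⊕ (Fin q ⊕ Fin q)) :=
    (Formula.conj (l.map (Formula.relabel (Sum.map id Sum.inl))) ⊓
      Formula.conj (l.map (Formula.relabel (Sum.map id Sum.inr)))) ⊓
      Formula.not ((Term.var (Sum.inr (Sum.inl w))).equal (Term.var (Sum.inr (Sum.inr w))))
  have hε : BoundedFormula.IsQF ε := by
    refine BoundedFormula.IsQF.inf (BoundedFormula.IsQF.inf (Formula.isQF_conj ?_)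
      (Formula.isQF_conj ?_)) (Formula.isLiteral_not_equal _ _).isQF
    all_goals
      simp only [List.forall_mem_map]
      exact fun φ hφ => ((hl φ hφ).relabel _).isQF
  have hε_iff : ∀ (N : ModelType.{u, v, max u v} T) (c : Fin p → N) (b : Fin q ⊕ Fin q → N),
      ε.Realize (Sum.elim c b) ↔ ((∀ φ ∈ l, φ.Realize (Sum.elim c (b ∘ Sum.inl))) ∧
        ∀ φ ∈ l, φ.Realize (Sum.elim c (b ∘ Sum.inr))) ∧ b (Sum.inl w) ≠ b (Sum.inr w) := by
    intro N c b
    simp only [ε, Formula.realize_inf, Formula.realize_conj, Formula.realize_not,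
      Formula.realize_equal, List.forall_mem_map, Formula.realize_relabel, Sum.elim_comp_map,
      Function.comp_id, Term.realize_var, Sum.elim_inr, ne_eq]
  obtain ⟨ψ, hψ, hψ₁, hψ₂⟩ := hcov p (Fin q ⊕ Fin q) ε hε
  refine ⟨ψ, hψ, fun M c b hb hbw => ?_, fun M c hc => ?_⟩
  · by_contra hc
    -- Interpolation applies to constraints only, so `¬ψ` is replaced by a conjunction `κ` of
    -- literals true at `c` that implies it. Under `κ`, two copies of `l` cannot disagree at `w`.
    obtain ⟨κ, hκ, hκc, hκd⟩ := Formula.exists_literals_decide.{u, v, max u v} hψ c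
    rw [Formula.realize_conj] at hκc
    -- The unknown `w` takes the role of the distinguished variable `y`; its old position `Sum.inl
    -- w` stays as a variable that does not occur.
    let e : Fin q → Fin q ⊕ Unit := fun j => if j = w then Sum.inr () else Sum.inl j
    let l' : List (L.Formula (Fin p ⊕ (Fin q ⊕ Unit))) :=
      κ.map (Formula.relabel Sum.inl) ++ l.map (Formula.relabel (Sum.map id e))
    have hl' : ∀ φ ∈ l', φ.IsLiteral := by
      simp only [l', List.forall_mem_append, List.forall_mem_map]
      exact ⟨fun φ hφ => (hκ φ hφ).relabel _, fun φ hφ => (hl φ hφ).relabel _⟩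
    have hl'_iff : ∀ (N : ModelType.{u, v, max u v} T) (c : Fin p → N) (b : Fin q ⊕ Unit → N),
        (Formula.conj l').Realize (Sum.elim c b) ↔ (∀ φ ∈ κ, φ.Realize c) ∧
          ∀ φ ∈ l, φ.Realize (Sum.elim c (b ∘ e)) := by
      intro N c b
      simp only [l', Formula.realize_conj, List.forall_mem_append, List.forall_mem_map,
        Formula.realize_relabel, Sum.elim_comp_map, Sum.elim_comp_inl, Function.comp_id]
    have hew : e w = Sum.inr () := if_pos rfl
    obtain ⟨t, ht⟩ := hT p q q _ _ (Formula.isConstraint_conj hl') (Formula.isConstraint_conj hl')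
      (models_formula_iff.2 fun N x => by
        obtain ⟨c', x', rfl⟩ : ∃ c' x', x = Sum.elim c' x' :=
          ⟨_, _, (Sum.elim_comp_inl_inr x).symm⟩
        obtain ⟨b₁, b₂, rfl⟩ : ∃ b₁ b₂, x' = Sum.elim b₁ b₂ :=
          ⟨_, _, (Sum.elim_comp_inl_inr x').symm⟩
        simp only [Formula.realize_imp, Formula.realize_inf, Formula.realize_relabel,
          Sum.elim_comp_map, Function.comp_id, Sum.elim_comp_inl, Sum.elim_comp_inr,
          Formula.realize_equal, Term.realize_var, Sum.elim_inl, Sum.elim_inr]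
        rw [hl'_iff, hl'_iff]
        rintro ⟨⟨hκ', h₁⟩, -, h₂⟩
        by_contra hne
        refine hc ((hκd N c' ((Formula.realize_conj _ _).2 hκ')).1
          (hψ₁ N c' (Sum.elim (b₁ ∘ e) (b₂ ∘ e)) ((hε_iff _ _ _).2 ⟨⟨h₁, h₂⟩, ?_⟩)))
        simpa [hew] using hne)
    rw [models_formula_iff] at ht
    have hbe : (Sum.elim b fun _ => b w) ∘ e = b := by
      funext j
      by_cases hj : j = w <;> simp [e, hj]
    -- Both copies receive the same solution `b`, so the interpolating term evaluates to `b w`.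
    have := ht M (Sum.elim c (Sum.elim (Sum.elim b fun _ => b w) (Sum.elim b fun _ => b w)))
    simp only [Formula.realize_imp, Formula.realize_inf, Formula.realize_relabel,
      Sum.elim_comp_map, Function.comp_id, Sum.elim_comp_inl, Sum.elim_comp_inr,
      Formula.realize_equal, Term.realize_var, Sum.elim_inl, Sum.elim_inr, hl'_iff, hbe,
      Term.realize_relabel, and_self] at this
    exact hbw t (this ⟨hκc, hb⟩)
  · obtain ⟨N, f, b, hb⟩ := hψ₂ M c hc
    rw [hε_iff] at hb
    exact ⟨N, f, b ∘ Sum.inl, b ∘ Sum.inr, hb.1.1, hb.1.2, hb.2⟩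

/-- A property of tuples in models of `T` that follows from a quantifier-free formula true at the
tuple `a`. -/
def QFEventually {M : Type max u v} [L.Structure M] {n : ℕ} (a : Fin n → M)
    (Q : ∀ N : ModelType.{u, v, max u v} T, (Fin n → N) → Prop) : Prop :=
  ∃ θ : L.Formula (Fin n), BoundedFormula.IsQF θ ∧ θ.Realize a ∧
    ∀ (N : ModelType.{u, v, max u v} T) (x : Fin n → N), θ.Realize x → Q N x

namespace QFEventually

variable {M : Type max u v} [L.Structure M] {n : ℕ} {a : Fin n → M}

theorem of_isQF {θ : L.Formula (Fin n)} (hθ : BoundedFormula.IsQF θ) (h : θ.Realize a) :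
    QFEventually (T := T) a fun _ x => θ.Realize x :=
  ⟨θ, hθ, h, fun _ _ => id⟩

theorem mono {Q Q' : ∀ N : ModelType.{u, v, max u v} T, (Fin n → N) → Prop}
    (h : QFEventually a Q) (h' : ∀ N x, Q N x → Q' N x) : QFEventually a Q' := by
  obtain ⟨θ, h₁, h₂, h₃⟩ := h
  exact ⟨θ, h₁, h₂, fun N x hx => h' N x (h₃ N x hx)⟩

theorem forall_mem {ι : Type*} (s : Finset ι)
    {Q : ι → ∀ N : ModelType.{u, v, max u v} T, (Fin n → N) → Prop}
    (h : ∀ i ∈ s, QFEventually a (Q i)) : QFEventually a fun N x => ∀ i ∈ s, Q i N x := by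
  choose θ h₁ h₂ h₃ using h
  refine ⟨Formula.conj (s.attach.toList.map fun i => θ i.1 i.2), Formula.isQF_conj ?_,
    (Formula.realize_conj _ _).2 ?_, fun N x hx i hi => h₃ i hi N x ?_⟩
  · simp only [List.forall_mem_map]
    exact fun i _ => h₁ i.1 i.2
  · simp only [List.forall_mem_map]
    exact fun i _ => h₂ i.1 i.2
  · rw [Formula.realize_conj, List.forall_mem_map] at hx
    exact hx ⟨i, hi⟩ (by simp)

theorem forall_finite {ι : Type*} [Finite ι]
    {Q : ι → ∀ N : ModelType.{u, v, max u v} T, (Fin n → N) → Prop}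
    (h : ∀ i, QFEventually a (Q i)) : QFEventually a fun N x => ∀ i, Q i N x := by
  have := Fintype.ofFinite ι
  obtain ⟨θ, h₁, h₂, h₃⟩ := forall_mem Finset.univ fun i _ => h i
  exact ⟨θ, h₁, h₂, fun N x hx i => h₃ N x hx i (Finset.mem_univ i)⟩

theorem imp {P : Prop} {Q : ∀ N : ModelType.{u, v, max u v} T, (Fin n → N) → Prop}
    (h : P → QFEventually a Q) : QFEventually a fun N x => P → Q N x := by
  by_cases hP : P
  · obtain ⟨θ, h₁, h₂, h₃⟩ := h hP
    exact ⟨θ, h₁, h₂, fun N x hx _ => h₃ N x hx⟩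
  · exact ⟨⊤, .top, Formula.realize_top.2 trivial, fun _ _ _ hP' => absurd hP' hP⟩

theorem and {Q₁ Q₂ : ∀ N : ModelType.{u, v, max u v} T, (Fin n → N) → Prop}
    (h₁ : QFEventually a Q₁) (h₂ : QFEventually a Q₂) :
    QFEventually a fun N x => Q₁ N x ∧ Q₂ N x := by
  obtain ⟨θ₁, h₁, h₁', h₁''⟩ := h₁
  obtain ⟨θ₂, h₂, h₂', h₂''⟩ := h₂
  exact ⟨θ₁ ⊓ θ₂, h₁.inf h₂, Formula.realize_inf.2 ⟨h₁', h₂'⟩, fun N x hx =>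
    ⟨h₁'' N x (Formula.realize_inf.1 hx).1, h₂'' N x (Formula.realize_inf.1 hx).2⟩⟩

end QFEventually

/-- A theory has covers if the solvability of quantifier-free formulas in extensions always follows
from a quantifier-free formula. -/
theorem hasCovers_of_qfEventually
    (h : ∀ (n : ℕ) (β : Type) [Finite β] (ε : L.Formula (Fin n ⊕ β)), BoundedFormula.IsQF ε →
      ∀ (M : ModelType.{u, v, max u v} T) (a : Fin n → M) (b : β → M), ε.Realize (Sum.elim a b) →
        QFEventually (T := T) a fun M' a' => ∃ (N : ModelType.{u, v, max u v} T) (f : M' ↪[L] N)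
          (b' : β → N), ε.Realize (Sum.elim (f ∘ a') b')) : T.HasCovers := by
  classical
  intro n β _ ε hε
  let Ext : ∀ M : ModelType.{u, v, max u v} T, (Fin n → M) → Prop := fun M a =>
    ∃ (N : ModelType.{u, v, max u v} T) (f : M ↪[L] N) (b : β → N), ε.Realize (Sum.elim (f ∘ a) b)
  let G : Set (L.Formula (Fin n)) := {θ | BoundedFormula.IsQF θ ∧
    ∀ (M : ModelType.{u, v, max u v} T) (a : Fin n → M), θ.Realize a → Ext M a}
  let neg : L.Formula (Fin n) → L.Formula (Fin n ⊕ β) := fun θ =>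
    Formula.not (θ.relabel Sum.inl)
  -- `ε` is inconsistent with the negations of all formulas in `G`, by the hypothesis. Compactness
  -- leaves finitely many of them, and their disjunction is the cover.
  obtain ⟨s, hs, hcon⟩ : ∃ s : Finset (L.Formula (Fin n ⊕ β)),
      (s : Set (L.Formula (Fin n ⊕ β))) ⊆ {ε} ∪ neg '' G ∧
      ∀ (N : ModelType.{u, v, max u v} T) (x : Fin n ⊕ β → N), ∃ φ ∈ s, ¬ φ.Realize x := by
    by_contra hcon
    push Not at hcon
    obtain ⟨N, x, hx⟩ := exists_realize_of_finite.{u, v, 0} T _ hcon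
    obtain ⟨θ, hθ, hθx, hθ'⟩ := h n β ε hε N (x ∘ Sum.inl) (x ∘ Sum.inr)
      (by rw [Sum.elim_comp_inl_inr]; exact hx _ (Or.inl rfl))
    have := hx _ (Or.inr ⟨θ, ⟨hθ, hθ'⟩, rfl⟩)
    rw [Formula.realize_not, Formula.realize_relabel] at this
    exact this hθx
  obtain ⟨s', hs'G, hs'⟩ := Finset.subset_set_image_iff.1
    (show ((s.filter (· ∈ neg '' G) : Finset _) : Set _) ⊆ neg '' G from
      fun φ hφ => (Finset.mem_filter.1 hφ).2)
  have hψ_iff : ∀ (M : ModelType.{u, v, max u v} T) (a : Fin n → M),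
      (Formula.not (Formula.conj (s'.toList.map Formula.not))).Realize a ↔
        ∃ θ ∈ s', θ.Realize a := by
    intro M a
    simp only [Formula.realize_not, Formula.realize_conj, List.forall_mem_map, Finset.mem_toList,
      not_forall, not_not, exists_prop]
  refine ⟨Formula.not (Formula.conj (s'.toList.map Formula.not)), ?_, fun M a b hab => ?_,
    fun M a ha => ?_⟩
  · refine (Formula.isQF_conj ?_).not
    simp only [List.forall_mem_map, Finset.mem_toList]
    exact fun θ hθ => (hs'G hθ).1.not
  · obtain ⟨φ, hφs, hφ⟩ := hcon M (Sum.elim a b)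
    rcases hs hφs with rfl | hφG
    · exact absurd hab hφ
    · have : φ ∈ s'.image neg := hs' ▸ Finset.mem_filter.2 ⟨hφs, hφG⟩
      obtain ⟨θ, hθ, rfl⟩ := Finset.mem_image.1 this
      exact (hψ_iff M a).2 ⟨θ, hθ, by simpa [neg] using hφ⟩
  · obtain ⟨θ, hθ, hθa⟩ := (hψ_iff M a).1 ha
    exact (hs'G hθ).2 M a hθa

end Theory
end FirstOrder.Language

namespace FirstOrder.Language

variable {L S : Language.{u, v}}

/-! ### Reduction of quantifier-free formulas of a disjoint union to flat facts -/

/-- The flat facts about a tuple of elements of a structure for `L.sum S`: literals in `L`, and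
values of the function and relation symbols of `S`. -/
inductive FlatFact (L S : Language.{u, v}) (M : Type max u v) : Type max u v
  | lit (φ : L.Formula M) (h : φ.IsLiteral) : FlatFact L S M
  | func {k : ℕ} (f : S.Functions k) (xs : Fin k → M) : FlatFact L S M
  | rel {k : ℕ} (R : S.Relations k) (xs : Fin k → M) : FlatFact L S M

namespace FlatFact

variable {M : Type max u v} [L.Structure M]

/-- A map preserves a fact. -/
def Preserved [S.Structure M] {N : Type max u v} [L.Structure N] [S.Structure N] (g : M → N) : FlatFact L S M → Prop
  | lit φ _ => φ.Realize (id : M → M) → φ.Realize g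
  | func f xs => g (Structure.funMap f xs) = Structure.funMap f (g ∘ xs)
  | rel R xs => Structure.RelMap R (g ∘ xs) ↔ Structure.RelMap R xs

open Classical in
/-- The elements mentioned in a fact. -/
noncomputable def support [S.Structure M] : FlatFact L S M → Finset M
  | lit φ _ => φ.freeVarFinset
  | func f xs => insert (Structure.funMap f xs) (Finset.univ.image xs)
  | rel _ xs => Finset.univ.image xs

open Classical in
/-- The literal of `L` expressed by a fact, if it is a true literal. -/
noncomputable def trueLits : FlatFact L S M → List (L.Formula M)
  | lit φ _ => if φ.Realize (id : M → M) then [φ] else []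
  | _ => []

theorem mem_trueLits {F : FlatFact L S M} {φ : L.Formula M} :
    φ ∈ F.trueLits ↔ ∃ h : φ.IsLiteral, F = lit φ h ∧ φ.Realize (id : M → M) := by
  cases F with
  | lit ψ h =>
    by_cases hψ : ψ.Realize (id : M → M)
    · simp only [trueLits, hψ, if_true, List.mem_singleton, lit.injEq]
      constructor
      · rintro rfl
        exact ⟨h, rfl, hψ⟩
      · rintro ⟨-, rfl, -⟩
        rfl
    · simp only [trueLits, hψ, if_false, List.not_mem_nil, lit.injEq, false_iff]
      rintro ⟨-, rfl, h⟩
      exact hψ h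
  | func f xs => simp [trueLits]
  | rel R xs => simp [trueLits]

section

variable [S.Structure M] [(L.sum S).Structure M] [(LHom.sumInl : L →ᴸ L.sum S).IsExpansionOn M]
  [(LHom.sumInr : S →ᴸ L.sum S).IsExpansionOn M]

/-- Flattening: every subterm is replaced by its value in `M`, so that each function symbol
contributes one fact about elements. -/
theorem exists_preserved_term {γ : Type*} (x : γ → M) (t : (L.sum S).Term γ) :
    ∃ F : Finset (FlatFact L S M), ∀ (N : Type max u v) [L.Structure N] [S.Structure N]
      [(L.sum S).Structure N] [(LHom.sumInl : L →ᴸ L.sum S).IsExpansionOn N]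
      [(LHom.sumInr : S →ᴸ L.sum S).IsExpansionOn N] (g : M → N),
      (∀ φ ∈ F, φ.Preserved g) → t.realize (g ∘ x) = g (t.realize x) := by
  classical
  induction t with
  | var a => exact ⟨∅, fun N _ _ _ _ _ g _ => rfl⟩
  | @func k f ts ih =>
    choose F hF using ih
    rcases f with f | f
    · refine ⟨insert (lit (((Term.func f fun i => Term.var ((ts i).realize x)).equal
        (Term.var (Structure.funMap f fun i => (ts i).realize x)))) (Formula.isLiteral_equal _ _))
        (Finset.univ.biUnion F), fun N _ _ _ _ _ g hg => ?_⟩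
      have h₁ := hg _ (Finset.mem_insert_self _ _)
      have h₂ : ∀ i, (ts i).realize (g ∘ x) = g ((ts i).realize x) := fun i => hF i N g fun φ hφ =>
        hg φ (Finset.mem_insert_of_mem (Finset.mem_biUnion.2 ⟨i, Finset.mem_univ i, hφ⟩))
      simp only [Preserved, Formula.realize_equal, Term.realize_func, Term.realize_var, id,
        true_implies] at h₁
      exact ((congrArg (Structure.funMap (L := L.sum S) (Sum.inl f)) (funext h₂)).trans
        ((LHom.sumInl : L →ᴸ L.sum S).map_onFunction f _)).trans
        (h₁.trans (congrArg g ((LHom.sumInl : L →ᴸ L.sum S).map_onFunction f _).symm))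
    · refine ⟨insert (func f fun i => (ts i).realize x) (Finset.univ.biUnion F),
        fun N _ _ _ _ _ g hg => ?_⟩
      have h₁ := hg _ (Finset.mem_insert_self _ _)
      have h₂ : ∀ i, (ts i).realize (g ∘ x) = g ((ts i).realize x) := fun i => hF i N g fun φ hφ =>
        hg φ (Finset.mem_insert_of_mem (Finset.mem_biUnion.2 ⟨i, Finset.mem_univ i, hφ⟩))
      simp only [Preserved] at h₁
      exact ((congrArg (Structure.funMap (L := L.sum S) (Sum.inr f)) (funext h₂)).trans
        ((LHom.sumInr : S →ᴸ L.sum S).map_onFunction f _)).trans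
        (h₁.symm.trans (congrArg g ((LHom.sumInr : S →ᴸ L.sum S).map_onFunction f _).symm))

/-- The truth of a quantifier-free formula of `L.sum S` is preserved by each map that preserves
certain finitely many flat facts. -/
theorem exists_preserved_formula {γ : Type*} (x : γ → M) {δ : (L.sum S).Formula γ}
    (hδ : BoundedFormula.IsQF δ) :
    ∃ F : Finset (FlatFact L S M), ∀ (N : Type max u v) [L.Structure N] [S.Structure N]
      [(L.sum S).Structure N] [(LHom.sumInl : L →ᴸ L.sum S).IsExpansionOn N]
      [(LHom.sumInr : S →ᴸ L.sum S).IsExpansionOn N] (g : M → N),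
      (∀ φ ∈ F, φ.Preserved g) → (δ.Realize (g ∘ x) ↔ δ.Realize x) := by
  classical
  have helim : ∀ (N : Type max u v) (g : M → N),
      (Sum.elim (g ∘ x) (default : Fin 0 → N)) = g ∘ Sum.elim x default := fun N g => by
    rw [Sum.comp_elim]
    exact congrArg _ (Subsingleton.elim _ _)
  induction hδ with
  | falsum => exact ⟨∅, fun N _ _ _ _ _ g _ => Iff.rfl⟩
  | of_isAtomic h =>
    cases h with
    | equal t₁ t₂ =>
      obtain ⟨F₁, h₁⟩ := exists_preserved_term (Sum.elim x default) t₁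
      obtain ⟨F₂, h₂⟩ := exists_preserved_term (Sum.elim x default) t₂
      -- Every map preserves equality, so only the inequality has to be recorded.
      refine ⟨insert (lit (Formula.not ((Term.var (t₁.realize (Sum.elim x default))).equal
        (Term.var (t₂.realize (Sum.elim x default))))) (Formula.isLiteral_not_equal _ _))
        (F₁ ∪ F₂), fun N _ _ _ _ _ g hg => ?_⟩
      have h := hg _ (Finset.mem_insert_self _ _)
      simp only [Preserved, Formula.realize_not, Formula.realize_equal, Term.realize_var, id] at h
      rw [Formula.Realize, Formula.Realize, BoundedFormula.realize_bdEqual,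
        BoundedFormula.realize_bdEqual, helim,
        h₁ N g fun φ hφ => hg φ (by simp [hφ]), h₂ N g fun φ hφ => hg φ (by simp [hφ])]
      exact ⟨fun h' => by_contra fun hne => h hne h', fun h' => congrArg g h'⟩
    | @rel k R ts =>
      choose F hF using fun i => exists_preserved_term (Sum.elim x default) (ts i)
      rcases R with R | R
      · refine ⟨insert (lit (R.formula fun i => Term.var ((ts i).realize (Sum.elim x default)))
          (Formula.isLiteral_rel _ _))
          (insert (lit (Formula.not (R.formula fun i =>
          Term.var ((ts i).realize (Sum.elim x default)))) (Formula.isLiteral_not_rel _ _))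
          (Finset.univ.biUnion F)), fun N _ _ _ _ _ g hg => ?_⟩
        have h₁ := hg _ (Finset.mem_insert_self _ _)
        have h₂ := hg _ (Finset.mem_insert_of_mem (Finset.mem_insert_self _ _))
        have h₃ : ∀ i, (ts i).realize (g ∘ Sum.elim x default) =
            g ((ts i).realize (Sum.elim x default)) := fun i => hF i N g fun φ hφ =>
          hg φ (Finset.mem_insert_of_mem (Finset.mem_insert_of_mem
            (Finset.mem_biUnion.2 ⟨i, Finset.mem_univ i, hφ⟩)))
        simp only [Preserved, Formula.realize_not, Formula.realize_rel, Term.realize_var, id]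
          at h₁ h₂
        rw [← helim] at h₃
        refine (iff_of_eq ((congrArg (Structure.RelMap (L := L.sum S) (Sum.inl R))
          (funext h₃)).trans ((LHom.sumInl : L →ᴸ L.sum S).map_onRelation R _))).trans
          (_root_.Iff.trans ?_ (iff_of_eq ((LHom.sumInl : L →ᴸ L.sum S).map_onRelation R _).symm))
        exact ⟨fun h' => by_contra fun hne => h₂ hne h', h₁⟩
      · refine ⟨insert (rel R fun i => (ts i).realize (Sum.elim x default))
          (Finset.univ.biUnion F), fun N _ _ _ _ _ g hg => ?_⟩
        have h₁ := hg _ (Finset.mem_insert_self _ _)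
        have h₃ : ∀ i, (ts i).realize (g ∘ Sum.elim x default) =
            g ((ts i).realize (Sum.elim x default)) := fun i => hF i N g fun φ hφ =>
          hg φ (Finset.mem_insert_of_mem (Finset.mem_biUnion.2 ⟨i, Finset.mem_univ i, hφ⟩))
        simp only [Preserved] at h₁
        rw [← helim] at h₃
        exact (iff_of_eq ((congrArg (Structure.RelMap (L := L.sum S) (Sum.inr R))
          (funext h₃)).trans ((LHom.sumInr : S →ᴸ L.sum S).map_onRelation R _))).trans
          (h₁.trans (iff_of_eq ((LHom.sumInr : S →ᴸ L.sum S).map_onRelation R _).symm))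
  | imp _ _ ih₁ ih₂ =>
    obtain ⟨F₁, h₁⟩ := ih₁
    obtain ⟨F₂, h₂⟩ := ih₂
    exact ⟨F₁ ∪ F₂, fun N _ _ _ _ _ g hg => imp_congr
      (h₁ N g fun φ hφ => hg φ (by simp [hφ])) (h₂ N g fun φ hφ => hg φ (by simp [hφ]))⟩

end

end FlatFact

/-- Extension of an `S`-structure from `M'` to a larger set `N`, such that on a finite family `z`
of elements of `N` the symbols behave as on the family `e` of elements of `M`, wherever the values
are not prescribed by `M'`. -/
theorem exists_structure_extension {M M' N ι : Type*} [S.Structure M] [S.Structure M'] [Nonempty N]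
    {f : M' → N} (hf : Function.Injective f) {z : ι → N} (hz : Function.Injective z)
    {e : ι → M} (he : Function.Injective e) :
    ∃ _ : S.Structure N,
      (∀ {k : ℕ} (F : S.Functions k) (ys : Fin k → M'),
        f (Structure.funMap F ys) = Structure.funMap F (f ∘ ys)) ∧
      (∀ {k : ℕ} (R : S.Relations k) (ys : Fin k → M'),
        Structure.RelMap R (f ∘ ys) ↔ Structure.RelMap R ys) ∧
      (∀ {k : ℕ} (F : S.Functions k) (is : Fin k → ι) (j : ι), (¬ ∃ ys, f ∘ ys = z ∘ is) →
        Structure.funMap F (e ∘ is) = e j → Structure.funMap F (z ∘ is) = z j) ∧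
      (∀ {k : ℕ} (R : S.Relations k) (is : Fin k → ι), (¬ ∃ ys, f ∘ ys = z ∘ is) →
        (Structure.RelMap R (z ∘ is) ↔ Structure.RelMap R (e ∘ is))) := by
  classical
  refine ⟨
    { funMap := fun {k} F xs =>
        -- The values in `M'` take precedence; next come the values imitated from `M`, which are
        -- well defined since `z` and `e` are injective; elsewhere the choice is arbitrary.
        if h : ∃ ys, f ∘ ys = xs then f (Structure.funMap F h.choose)
        else if h : ∃ (is : Fin k → ι) (j : ι), z ∘ is = xs ∧ Structure.funMap F (e ∘ is) = e j then
          z h.choose_spec.choose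
        else Classical.arbitrary N
      RelMap := fun {k} R xs => (∃ ys, f ∘ ys = xs ∧ Structure.RelMap R ys) ∨
        ((¬ ∃ ys, f ∘ ys = xs) ∧ ∃ is : Fin k → ι, z ∘ is = xs ∧ Structure.RelMap R (e ∘ is)) },
    fun {k} F ys => ?_, fun {k} R ys => ?_, fun {k} F is j hn h => ?_,
    fun {k} R is hn => ?_⟩
  · have h : ∃ ys', f ∘ ys' = f ∘ ys := ⟨ys, rfl⟩
    have h' : h.choose = ys := hf.comp_left h.choose_spec
    change _ = dite _ _ _
    rw [dif_pos h, h']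
  · constructor
    · rintro (⟨ys', h, h'⟩ | ⟨h, -⟩)
      · rwa [← hf.comp_left h]
      · exact absurd ⟨ys, rfl⟩ h
    · exact fun h => Or.inl ⟨ys, rfl, h⟩
  · have h' : ∃ (is' : Fin k → ι) (j : ι), z ∘ is' = z ∘ is ∧
        Structure.funMap F (e ∘ is') = e j := ⟨is, j, rfl, h⟩
    change dite _ _ _ = _
    rw [dif_neg hn, dif_pos h']
    have h₁ := h'.choose_spec.choose_spec.1
    have h₂ := h'.choose_spec.choose_spec.2
    have h₃ := congrArg (fun is' => Structure.funMap F (e ∘ is')) (hz.comp_left h₁)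
    exact congrArg z (he (h₂.symm.trans (h₃.trans h)))
  · constructor
    · rintro (⟨ys, h, -⟩ | ⟨-, is', h, h'⟩)
      · exact absurd ⟨ys, h⟩ hn
      · rwa [← hz.comp_left h]
    · exact fun h => Or.inr ⟨hn, is, rfl, h⟩

end FirstOrder.Language

/-! ### Sufficiency: covers for the disjoint union, and the theorem -/

namespace FirstOrder.Language

variable {L S : Language.{u, v}}

/-- An enumeration of a finite set that separates a subset from its complement. -/
theorem exists_fin_partition {M : Type*} (W : Finset M) (A : Set M) :
    ∃ (p q : ℕ) (e : Fin p ⊕ Fin q → M), Function.Injective e ∧ (∀ m ∈ W, ∃ i, e i = m) ∧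
      (∀ i, e (Sum.inl i) ∈ A) ∧ ∀ j, e (Sum.inr j) ∉ A := by
  classical
  let e₁ := (W.filter (· ∈ A)).equivFin
  let e₂ := (W.filter (· ∉ A)).equivFin
  have h₁ : ∀ i, ((e₁.symm i : M)) ∈ A := fun i => (Finset.mem_filter.1 (e₁.symm i).2).2
  have h₂ : ∀ i, ((e₂.symm i : M)) ∉ A := fun i => (Finset.mem_filter.1 (e₂.symm i).2).2
  refine ⟨_, _, Sum.elim (fun i => (e₁.symm i : M)) (fun i => (e₂.symm i : M)), ?_, ?_, h₁, h₂⟩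
  · refine Function.Injective.sumElim (Subtype.val_injective.comp e₁.symm.injective)
      (Subtype.val_injective.comp e₂.symm.injective) fun i j h => h₂ j ?_
    rw [← h]
    exact h₁ i
  · intro m hm
    by_cases hA : m ∈ A
    · exact ⟨Sum.inl (e₁ ⟨m, Finset.mem_filter.2 ⟨hm, hA⟩⟩), by simp⟩
    · exact ⟨Sum.inr (e₂ ⟨m, Finset.mem_filter.2 ⟨hm, hA⟩⟩), by simp⟩

namespace FlatFact

/-- A partial map, given by two tuples, preserves an `S`-fact as far as it lies in its domain. -/
def Respected {M M' : Type max u v} [S.Structure M] [S.Structure M'] {p : ℕ} (e : Fin p → M)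
    (c : Fin p → M') : FlatFact L S M → Prop
  | lit _ _ => True
  | func (k := k) f xs => ∀ (is : Fin k → Fin p) (j : Fin p), e ∘ is = xs →
      Structure.funMap f xs = e j → Structure.funMap f (c ∘ is) = c j
  | rel (k := k) R xs => ∀ is : Fin k → Fin p, e ∘ is = xs →
      (Structure.RelMap R (c ∘ is) ↔ Structure.RelMap R xs)

-- Only finitely many index tuples are involved, and each requirement on them is an atomic formula
-- in the terms `σ`, or the negation of one.
open Theory in
theorem qfEventually_respected {T : (L.sum S).Theory} {M : Type max u v} [S.Structure M]
    [(L.sum S).Structure M] [(LHom.sumInr : S →ᴸ L.sum S).IsExpansionOn M] {n p : ℕ}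
    (a : Fin n → M) (σ : Fin p → (L.sum S).Term (Fin n)) (G : FlatFact L S M) :
    QFEventually (T := T) a fun M' a' =>
      letI : S.Structure M' := (LHom.sumInr : S →ᴸ L.sum S).reduct M'
      G.Respected (fun i => (σ i).realize a) fun i => (σ i).realize a' := by
  cases G with
  | lit φ h =>
    exact ⟨(⊤ : (L.sum S).Formula (Fin n)), .top, Formula.realize_top.2 trivial,
      fun _ _ _ => trivial⟩
  | @func k f xs =>
    refine QFEventually.forall_finite fun is => QFEventually.forall_finite fun j =>
      QFEventually.imp fun h => QFEventually.imp fun h' => ?_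
    refine (QFEventually.of_isQF (θ := (Term.func (L := L.sum S) (Sum.inr f)
      fun i => σ (is i)).equal (σ j)) (Formula.isLiteral_equal _ _).isQF ?_).mono ?_
    · rw [Formula.realize_equal]
      refine Eq.trans ?_ h'
      rw [← h]
      exact (LHom.sumInr : S →ᴸ L.sum S).map_onFunction f _
    · intro M' a' ha'
      rw [Formula.realize_equal] at ha'
      exact ha'
  | @rel k R xs =>
    refine QFEventually.forall_finite fun is => QFEventually.imp fun h => ?_
    have hR : Structure.RelMap (L := L.sum S) (Sum.inr R) (fun i => (σ (is i)).realize a) ↔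
        Structure.RelMap R xs := by
      rw [← h]
      exact iff_of_eq ((LHom.sumInr : S →ᴸ L.sum S).map_onRelation R _)
    by_cases hxs : Structure.RelMap R xs
    · exact (QFEventually.of_isQF (θ := Relations.formula (L := L.sum S) (Sum.inr R)
        fun i => σ (is i)) (Formula.isLiteral_rel _ _).isQF
        ((Formula.realize_rel (L := L.sum S)).2 (hR.2 hxs))).mono fun M' a' ha' =>
          iff_of_true ((Formula.realize_rel (L := L.sum S)).1 ha') hxs
    · exact (QFEventually.of_isQF (θ := Formula.not (Relations.formula (L := L.sum S) (Sum.inr R)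
        fun i => σ (is i))) (Formula.isLiteral_not_rel _ _).isQF
        (fun h => hxs (hR.1 ((Formula.realize_rel (L := L.sum S)).1 h)))).mono fun M' a' ha' =>
          iff_of_false (fun h => ha' ((Formula.realize_rel (L := L.sum S)).2 h)) hxs

end FlatFact

namespace Theory

variable {T : L.Theory}

-- Four quantifier-free conditions on `a'` suffice: the terms `σ` reproduce `a'`, the constraint `l`
-- is solvable over them, no unknown is determined by them, and the `S`-facts among the generated
-- elements agree with those in `M`.
open FlatFact in
theorem hasCovers_disjointUnion_euf (hconv : T.IsConvex) (hcov : T.HasCovers)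
    (hT : T.IsEqualityInterpolating) : (T.disjointUnion (euf S)).HasCovers := by
  classical
  refine hasCovers_of_qfEventually fun n β _ ε hε M a b hab => ?_
  let _ : L.Structure M := (LHom.sumInl : L →ᴸ L.sum S).reduct M
  let _ : S.Structure M := (LHom.sumInr : S →ᴸ L.sum S).reduct M
  have hM : M ⊨ T := (models_disjointUnion_euf_iff (S := S) T M).1 M.is_model
  obtain ⟨F, hF⟩ := exists_preserved_formula (L := L) (S := S) (Sum.elim a b) hε
  obtain ⟨m₀⟩ := M.nonempty'
  -- The element `m₀` makes the index set nonempty, as needed for the inverse `r` of `e`.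
  let W : Finset M := insert m₀ (Finset.univ.image a ∪ F.biUnion support)
  have hWF : ∀ G ∈ F, ∀ m ∈ G.support, m ∈ W := fun G hG m hm =>
    Finset.mem_insert_of_mem (Finset.mem_union_right _ (Finset.mem_biUnion.2 ⟨G, hG, hm⟩))
  -- Generation is by terms of the whole language `L.sum S`, so generated elements are closed under
  -- the symbols of `S` too.
  obtain ⟨p, q, e, he, heW, heA, heN⟩ := exists_fin_partition W
    {m | ∃ t : (L.sum S).Term (Fin n), t.realize a = m}
  have : Nonempty (Fin p ⊕ Fin q) := ⟨(heW m₀ (Finset.mem_insert_self _ _)).choose⟩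
  let r : M → Fin p ⊕ Fin q := Function.invFun e
  have hr : ∀ m ∈ W, e (r m) = m := fun m hm => Function.invFun_eq (heW m hm)
  have hinl : ∀ i, (∃ t : (L.sum S).Term (Fin n), t.realize a = e i) → ∃ j, i = Sum.inl j := by
    rintro (j | j) h
    · exact ⟨j, rfl⟩
    · exact absurd h (heN j)
  choose σ hσ using heA
  have haj : ∀ i, ∃ j, r (a i) = Sum.inl j := fun i => hinl _ ⟨Term.var i,
    (hr _ (Finset.mem_insert_of_mem (Finset.mem_union_left _
      (Finset.mem_image_of_mem a (Finset.mem_univ i))))).symm⟩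
  choose ja hja using haj
  let ls : List (L.Formula M) := F.toList.flatMap trueLits
  -- Pairwise distinctness is part of the constraint: it makes every solution injective, so `S` can
  -- be copied along it without conflict.
  let l : List (L.Formula (Fin p ⊕ Fin q)) := ls.map (Formula.relabel r) ++
    (Finset.univ.offDiag (α := Fin p ⊕ Fin q)).toList.map fun i =>
      Formula.not ((Term.var i.1).equal (Term.var i.2))
  have hls : ∀ φ ∈ ls, ∃ h : φ.IsLiteral, lit φ h ∈ F ∧ φ.Realize (id : M → M) := by
    intro φ hφ
    obtain ⟨G, hG, hφG⟩ := List.mem_flatMap.1 hφ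
    obtain ⟨h, rfl, h'⟩ := mem_trueLits.1 hφG
    exact ⟨h, by simpa using hG, h'⟩
  have hl : ∀ φ ∈ l, φ.IsLiteral := by
    simp only [l, List.forall_mem_append, List.forall_mem_map]
    exact ⟨fun φ hφ => (hls φ hφ).choose.relabel _, fun i _ => Formula.isLiteral_not_equal _ _⟩
  have hl_iff : ∀ (N : ModelType.{u, v, max u v} T) (z : Fin p ⊕ Fin q → N),
      (∀ φ ∈ l, φ.Realize z) ↔ (∀ φ ∈ ls, φ.Realize (z ∘ r)) ∧ Function.Injective z := by
    intro N z
    simp only [l, List.forall_mem_append, List.forall_mem_map, Formula.realize_relabel,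
      Formula.realize_not, Formula.realize_equal, Term.realize_var, Finset.mem_toList,
      Finset.mem_offDiag, Finset.mem_univ, true_and, Prod.forall]
    exact and_congr_right fun _ =>
      ⟨fun h i j hij => by_contra fun hne => h i j hne hij, fun h i j hne hij => hne (h hij)⟩
  have hle : ∀ x : Fin p ⊕ Fin q → M, x = e →
      ∀ φ ∈ l, Formula.Realize (M := ModelType.of T M) φ x := by
    rintro x rfl
    refine (hl_iff (ModelType.of T M) x).2 ⟨fun φ hφ => ?_, he⟩
    obtain ⟨h, hφF, hφ'⟩ := hls φ hφ
    exact (Formula.realize_congr φ fun m hm => hr m (hWF _ hφF m hm)).2 hφ'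
  obtain ⟨ψ, hψ, hψ₁, hψ₂⟩ := hcov p (Fin q) (Formula.conj l)
    (Formula.isQF_conj fun φ hφ => (hl φ hφ).isQF)
  choose χ hχ hχ₁ hχ₂ using fun w => hT.exists_cover_ne hcov hl w
  have hsubst : ∀ (θ : L.Formula (Fin p)) (M' : ModelType.{u, v, max u v} (T.disjointUnion (euf S)))
      (a' : Fin n → M'), letI : L.Structure M' := (LHom.sumInl : L →ᴸ L.sum S).reduct M'
      Formula.Realize (BoundedFormula.subst ((LHom.sumInl : L →ᴸ L.sum S).onFormula θ) σ) a' ↔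
        θ.Realize fun i => (σ i).realize a' := by
    intro θ M' a'
    let _ : L.Structure M' := (LHom.sumInl : L →ᴸ L.sum S).reduct M'
    rw [Formula.Realize, BoundedFormula.realize_subst]
    exact LHom.realize_onFormula (LHom.sumInl : L →ᴸ L.sum S) θ
  have hσ' : (fun i => (σ i).realize a) = e ∘ Sum.inl := funext hσ
  have ev₁ : QFEventually (T := T.disjointUnion (euf S)) a fun M' a' =>
      ∀ i, (σ (ja i)).realize a' = a' i :=
    QFEventually.forall_finite fun i => (QFEventually.of_isQF
      (θ := (σ (ja i)).equal (Term.var i)) (Formula.isLiteral_equal _ _).isQF (by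
        rw [Formula.realize_equal, hσ, ← hja]
        exact hr _ (Finset.mem_insert_of_mem (Finset.mem_union_left _
          (Finset.mem_image_of_mem a (Finset.mem_univ i)))))).mono fun M' a' h => by
      rwa [Formula.realize_equal] at h
  have ev₂ := QFEventually.of_isQF (T := T.disjointUnion (euf S)) (a := a)
    (Formula.isQF_subst (LHom.isQF_onFormula (LHom.sumInl : L →ᴸ L.sum S) hψ) σ)
    ((hsubst ψ M a).2 (by
      rw [hσ']
      exact hψ₁ (ModelType.of T M) _ (e ∘ Sum.inr) ((Formula.realize_conj _ _).2
        (hle _ (Sum.elim_comp_inl_inr e)))))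
  have ev₃ := QFEventually.forall_finite fun w =>
    QFEventually.of_isQF (T := T.disjointUnion (euf S)) (a := a)
    (Formula.isQF_subst (LHom.isQF_onFormula (LHom.sumInl : L →ᴸ L.sum S) (hχ w)) σ)
    ((hsubst (χ w) M a).2 (by
      rw [hσ']
      refine hχ₁ w (ModelType.of T M) _ (e ∘ Sum.inr) ?_ fun t ht => ?_
      · exact hle _ (Sum.elim_comp_inl_inr e)
      -- An `L`-term in the generated elements becomes, after substitution of `σ`, a term in `a`; so
      -- no such term can give an unknown.
      · refine heN w ⟨((LHom.sumInl : L →ᴸ L.sum S).onTerm t).subst σ, ?_⟩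
        rw [Term.realize_subst, hσ', LHom.realize_onTerm]
        exact ht.symm))
  have ev₄ := QFEventually.forall_mem F fun G _ =>
    qfEventually_respected (T := T.disjointUnion (euf S)) a σ G
  refine (ev₁.and (ev₂.and (ev₃.and ev₄))).mono fun M' a' => ?_
  rintro ⟨h₁, h₂, h₃, h₄⟩
  let _ : L.Structure M' := (LHom.sumInl : L →ᴸ L.sum S).reduct M'
  let _ : S.Structure M' := (LHom.sumInr : S →ᴸ L.sum S).reduct M'
  have hM' : M' ⊨ T := (models_disjointUnion_euf_iff (S := S) T M').1 M'.is_model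
  let c : Fin p → M' := fun i => (σ i).realize a'
  obtain ⟨N, f, y, hy, hyf⟩ := hconv.exists_solution_not_mem (ModelType.of T M') hl c
    (by
      obtain ⟨N, f, b', hb'⟩ := hψ₂ (ModelType.of T M') c ((hsubst ψ M' a').1 h₂)
      exact ⟨N, f, b', (Formula.realize_conj _ _).1 hb'⟩)
    (fun w => hχ₂ w (ModelType.of T M') c ((hsubst (χ w) M' a').1 (h₃ w)))
  let z : Fin p ⊕ Fin q → N := Sum.elim (f ∘ c) y
  obtain ⟨hzl, hz⟩ := (hl_iff N z).1 hy
  obtain ⟨_, hfun, hrel, hfun', hrel'⟩ :=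
    exists_structure_extension (S := S) (M' := M') f.injective hz he
  have hN : N ⊨ T.disjointUnion (euf S) := (models_disjointUnion_euf_iff T N).2 inferInstance
  let f' : M' ↪[L.sum S] N := ⟨f.toEmbedding, fun {k} g ys => by
      rcases g with g | g
      · exact f.map_fun g ys
      · exact hfun g ys, fun {k} R ys => by
      rcases R with R | R
      · exact f.map_rel R ys
      · exact hrel R ys⟩
  -- The entries of `y` lie outside `M'`, so a tuple that falls into `M'` involves generated
  -- elements only; its `S`-facts are then settled by `h₄`.
  have hrange : ∀ {k : ℕ} (is : Fin k → Fin p ⊕ Fin q), (∃ ys, f ∘ ys = z ∘ is) →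
      ∃ is', is = Sum.inl ∘ is' := by
    rintro k is ⟨ys, hys⟩
    have : ∀ i, ∃ j, is i = Sum.inl j := fun i => by
      rcases hi : is i with j | w
      · exact ⟨j, rfl⟩
      · have := congrFun hys i
        simp only [Function.comp_apply, hi] at this
        exact absurd this.symm (hyf w (ys i))
    choose is' his' using this
    exact ⟨is', funext his'⟩
  rw [hσ'] at h₄
  have hpres : ∀ G ∈ F, G.Preserved (z ∘ r) := by
    intro G hG
    cases G with
    | lit φ h => exact fun hφ => hzl φ (List.mem_flatMap.2
        ⟨lit φ h, Finset.mem_toList.2 hG, mem_trueLits.2 ⟨h, rfl, hφ⟩⟩)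
    | @func k g xs =>
      have hxs : e ∘ r ∘ xs = xs := funext fun i => hr _ (hWF _ hG _
        (Finset.mem_insert_of_mem (Finset.mem_image_of_mem xs (Finset.mem_univ i))))
      have hv : e (r (Structure.funMap g xs)) = Structure.funMap g xs :=
        hr _ (hWF _ hG _ (Finset.mem_insert_self _ _))
      by_cases hys : ∃ ys, f ∘ ys = z ∘ r ∘ xs
      · obtain ⟨is, his⟩ := hrange _ hys
        have hxs' : (e ∘ Sum.inl) ∘ is = xs := by rw [← hxs, his]; rfl
        -- An `S`-function value at generated arguments is again generated, so the fact stays within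
        -- the scope of `h₄`.
        obtain ⟨j, hj⟩ := hinl (r (Structure.funMap g xs))
          ⟨Term.func (L := L.sum S) (Sum.inr g) fun i => σ (is i), by
            rw [hv, ← hxs', ← hσ']
            exact (LHom.sumInr : S →ᴸ L.sum S).map_onFunction g _⟩
        have := h₄ _ hG is j hxs' (by rw [← hv, hj]; rfl)
        change z (r (Structure.funMap g xs)) = Structure.funMap g (z ∘ r ∘ xs)
        rw [hj, his]
        exact (congrArg f this).symm.trans (hfun g (c ∘ is))
      · exact (hfun' g (r ∘ xs) _ hys (by rw [hxs, hv])).symm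
    | @rel k R xs =>
      have hxs : e ∘ r ∘ xs = xs := funext fun i => hr _ (hWF _ hG _
        (Finset.mem_image_of_mem xs (Finset.mem_univ i)))
      by_cases hys : ∃ ys, f ∘ ys = z ∘ r ∘ xs
      · obtain ⟨is, his⟩ := hrange _ hys
        have hxs' : (e ∘ Sum.inl) ∘ is = xs := by rw [← hxs, his]; rfl
        change Structure.RelMap R (z ∘ r ∘ xs) ↔ _
        rw [his]
        exact (hrel R (c ∘ is)).trans (h₄ _ hG is hxs')
      · have := hrel' R (r ∘ xs) hys
        rwa [hxs] at this
  have hεN := (hF N (z ∘ r) hpres).2 hab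
  have hx : (z ∘ r) ∘ Sum.elim a b = Sum.elim (f ∘ a') ((z ∘ r) ∘ b) := by
    funext i
    rcases i with i | i
    · change z (r (a i)) = f (a' i)
      rw [hja, ← h₁ i]
      rfl
    · rfl
  rw [hx] at hεN
  exact ⟨ModelType.of _ N, f', (z ∘ r) ∘ b, hεN⟩

end Theory
end FirstOrder.Language

theorem mainTheorem2 (L S : FirstOrder.Language.{u, v}) [Countable L.Symbols] [Countable S.Symbols]
    (hconst : Nonempty L.Constants) (hpred : Nonempty (S.Relations 1))
    (T : L.Theory) (huniv : T.IsUniversal) (hconv : T.IsConvex) (hsi : T.IsStablyInfinite)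
    (hmc : T.HasModelCompletion) :
    (T.disjointUnion (FirstOrder.Language.Theory.euf S)).HasModelCompletion ↔
      T.IsEqualityInterpolating := by
  refine ⟨fun h => FirstOrder.Language.Theory.isEqualityInterpolating_of_hasCovers hconst hpred
    hconv h.hasCovers, fun h => (FirstOrder.Language.Theory.hasCovers_disjointUnion_euf hconv
    hmc.hasCovers h).hasModelCompletion fun N A _ f => ?_⟩
  let _ : L.Structure N := (FirstOrder.Language.LHom.sumInl : L →ᴸ L.sum S).reduct N
  let _ : L.Structure A := (FirstOrder.Language.LHom.sumInl : L →ᴸ L.sum S).reduct A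
  have hN : N ⊨ T :=
    (FirstOrder.Language.Theory.models_disjointUnion_euf_iff (S := S) T N).1 N.is_model
  let f' : A ↪[L] N := ⟨f.toEmbedding, fun g xs => f.map_fun (Sum.inl g) xs,
    fun R xs => f.map_rel (Sum.inl R) xs⟩
  exact (FirstOrder.Language.Theory.models_disjointUnion_euf_iff (S := S) T A).2
    (FirstOrder.Language.Theory.IsUniversal.models_of_embedding f')
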